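/- Let $s,k,l$ be integers with $1\le l\le k\le s$ and $k\mid s$, and let $\lambda,\mu>0$. Consider a 2-barrier $(s,k,l)$ system: there are $s$ workers, initially idle; jobs arrive with i.i.d. $\mathrm{Exp}(\lambda)$ inter-arrival times and are served first-come-first-served; each job has $k$ tasks, whose service times are i.i.d. $\mathrm{Exp}(\mu)$ (independent over jobs and of the arrivals) and which start simultaneously on $k$ workers as soon as $k$ workers are available; the job departs when $l$ of its $k$ tasks have finished; at that moment its remaining $k-l$ tasks are killed and all of its $k$ workers are released. For a job with task service times $X_1,\dots,X_k$ and order statistics $X_{(1:k)}\le\dots\le X_{(k:k)}$ let $$J_{\mathrm{tot}}=\sum_{i=1}^{l}X_{(i:k)}+(k-l)X_{(l:k)},\qquad J_{\mathrm{useful}}=\sum_{i=1}^{l}X_{(i:k)}$$ be the total and the useful server time of the job, and let $\varrho_{skl}=\lambda\,\mathsf E[J_{\mathrm{tot}}]/s$ and $\varrho_{\mathrm{useful}}=\lambda\,\mathsf E[J_{\mathrm{useful}}]/s$ be the utilization and the useful utilization. The system is called stable if the delay (departure time minus arrival time) of the $n$-th job converges in distribution, as $n\to\infty$, to a finite random variable.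 Let $H_n=\sum_{j=1}^n 1/j$, $H_0=0$. Then: 1. $\mathsf E[J_{\mathrm{tot}}]=\dfrac{l}{\mu}$ and $\mathsf E[J_{\mathrm{useful}}]=\dfrac1\mu\bigl(l-(k-l)(H_k-H_{k-l})\bigr)$ for every job. 2. The system is stable if and only if $\lambda<\dfrac{s\mu}{k(H_k-H_{k-l})}$. 3. For fixed $s,k,l,\mu$, the utilizations $\varrho_{skl}$ of the stable systems (as $\lambda$ varies) are exactly the numbers with $0<\varrho_{skl}<\varrho^{*}:=\dfrac{l}{k(H_k-H_{k-l})}$, and their useful utilizations $\varrho_{\mathrm{useful}}$ are exactly the numbers with $0<\varrho_{\mathrm{useful}}<\varrho^{*}-\dfrac{k-l}{k}$. -/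

import Mathlib

open MeasureTheory ProbabilityTheory Filter Set

universe u

noncomputable section

/-- The `i`-th order statistic `x_(i:n)` (`1 ≤ i ≤ n`): the least `t` such that at least `i` of the
numbers `x_1, …, x_n` are `≤ t`. -/
def orderStat {n : ℕ} (x : Fin n → ℝ) (i : ℕ) : ℝ :=
  sInf {t : ℝ | i ≤ (Finset.univ.filter fun j => x j ≤ t).card}

/-- Worker-level dynamics of a first-come-first-served system with `s` initially idle workers, in
which job `n` arrives at time `a n`, starts as soon as `k` workers are available, and holds these
`k` workers together for the time `σ n` (start and departure barrier).
`workerFree a σ k n w` is the time from which worker `w` is available, as seen by job `n`, i.e. when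
jobs `0, …, n - 1` have been placed. Job `n` takes the `k` workers that are available earliest;
so it starts at the later of `a n` and the `k`-th smallest of these times, and these `k` workers
become available again, in unison, when it departs. -/
def workerFree {s : ℕ} (a σ : ℕ → ℝ) (k : ℕ) : ℕ → Fin s → ℝ
  | 0 => fun _ => 0
  | n + 1 => fun w =>
      if ((Tuple.sort (workerFree (s := s) a σ k n)).symm w : ℕ) < k then
        max (a n) (orderStat (workerFree (s := s) a σ k n) k) + σ n
      else workerFree (s := s) a σ k n w

/-- The time at which job `n` starts. -/
def jobStart (s : ℕ) (a σ : ℕ → ℝ) (k n : ℕ) : ℝ :=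
  max (a n) (orderStat (workerFree (s := s) a σ k n) k)

/-- The random input of a 2-barrier `(s,k,l)` system with job arrival rate `lam` and task service
rate `μ`: independent exponential inter-arrival times of rate `lam`, and independent exponential
service times of rate `μ` for the `k` tasks of each of the jobs `0, 1, 2, …`. -/
structure SklSystem (s k l : ℕ) (lam μ : ℝ) where
  /-- the sample space -/
  Ω : Type u
  [mΩ : MeasurableSpace Ω]
  /-- the probability measure -/
  P : Measure Ω
  [isProb : IsProbabilityMeasure P]
  /-- the time between the arrivals of jobs `n - 1` and `n` (from time `0` if `n = 0`) -/
  interarrival : ℕ → Ω → ℝ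
  /-- the service time of task `i` of job `n` -/
  task : ℕ → Fin k → Ω → ℝ
  measurable_interarrival : ∀ n, Measurable (interarrival n)
  measurable_task : ∀ n i, Measurable (task n i)
  law_interarrival : ∀ n, P.map (interarrival n) = expMeasure lam
  law_task : ∀ n i, P.map (task n i) = expMeasure μ
  indep : iIndepFun (fun j : ℕ ⊕ (ℕ × Fin k) =>
    Sum.elim interarrival (fun p => task p.1 p.2) j) P

namespace SklSystem

attribute [instance] SklSystem.mΩ SklSystem.isProb

variable {s k l : ℕ} {lam μ : ℝ} (S : SklSystem.{u} s k l lam μ)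

/-- `X_(i:k)` for job `n`: the time from the start of the job to its `i`-th task completion. -/
def taskOrderStat (n i : ℕ) (ω : S.Ω) : ℝ := orderStat (fun j => S.task n j ω) i

/-- The arrival time of job `n`. -/
def arrival (n : ℕ) (ω : S.Ω) : ℝ := ∑ j ∈ Finset.range (n + 1), S.interarrival j ω

/-- The departure time of job `n`: it departs, and frees its `k` workers, when the `l`-th of its
tasks completes. -/
def departure (n : ℕ) (ω : S.Ω) : ℝ :=
  jobStart s (fun j => S.arrival j ω) (fun j => S.taskOrderStat j l ω) k n + S.taskOrderStat n l ω

/-- The delay (sojourn time) of job `n`. -/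
def sojourn (n : ℕ) (ω : S.Ω) : ℝ := S.departure n ω - S.arrival n ω

/-- Stability: the delay converges in distribution to the distribution of a finite (real-valued)
random variable. -/
def IsStable : Prop :=
  ∃ (ν : Measure ℝ) (_ : IsProbabilityMeasure ν),
    TendstoInDistribution S.sojourn atTop (id : ℝ → ℝ) (fun _ => S.P) ν

/-- `J_tot` for job `n`: the server time of the `l` tasks that complete, plus that of the `k - l`
tasks that are killed when the `l`-th one completes. -/
def totalServerTime (n : ℕ) (ω : S.Ω) : ℝ :=
  (∑ i ∈ Finset.Icc 1 l, S.taskOrderStat n i ω) + ((k : ℝ) - l) * S.taskOrderStat n l ω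

/-- `J_useful` for job `n`: the server time of the `l` tasks that complete. -/
def usefulServerTime (n : ℕ) (ω : S.Ω) : ℝ := ∑ i ∈ Finset.Icc 1 l, S.taskOrderStat n i ω

/-- The utilization `lam * E[J_tot] / s` (the jobs are identically distributed). -/
def utilization : ℝ := lam * (∫ ω, S.totalServerTime 0 ω ∂S.P) / s

/-- The useful utilization `lam * E[J_useful] / s`. -/
def usefulUtilization : ℝ := lam * (∫ ω, S.usefulServerTime 0 ω ∂S.P) / s

end SklSystem

end

/-!
The `k` workers that serve a job are released together, and `k` divides `s`. So the workers always
split into `m = s / k` groups of `k` workers that become available at the same times, and the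
barrier system is an ordinary first-come-first-served queue with `m` servers in which job `n` needs
the service `σ n = X_(l:k)`: see `sum_workerFree_eq` and `jobStart_add_sub_eq_delay`. The state of
that queue is the vector `W` of server workloads found by an arriving job (the Kiefer–Wolfowitz
recursion `workload`), and the delay is `min W + σ`. What remains is the stability theorem for the
GI/GI/m queue with square integrable input and unbounded inter-arrival times `τ`: it is stable if
and only if `E σ < m E τ`.

*Sufficiency.* The quadratic Lyapunov function `∑ i, W i ^ 2` has drift at most
`C - 2 (m E τ - E σ) E (min W)`, because `∑ i, W i ≥ m min W`; so the Cesàro means of `E (min W)`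
are bounded. A queue that starts empty is stochastically increasing, as it dominates, up to a
permutation of the servers, the queue without its first job (`exists_perm_workload_shift_le`). Hence
the means themselves are bounded. Reading the input backwards (`reversedDelay`) turns this
stochastic monotonicity into a pathwise one, so the reversed delays converge almost surely, to a
finite limit since their means are bounded, and the delays converge in distribution.

*Necessity.* Suppose the delays converge in distribution although `E σ ≥ m E τ`. The delays are
tight, so an arriving job finds, with a probability bounded below, that its server is going to be
idle for some time before the next arrival, and the mean total workload grows at least linearly,
by some `δ > 0` per job (`integral_sum_workload_succ_ge`). On the other hand, two servers differ by
at most the largest service requirement so far, so that the total workload is `m min W` up to a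
term with mean `o(n)`; and `min W`, being at most `σ 0 + ⋯ + σ (n - 1)` with second moment
`O(n ^ 2)`, is uniformly integrable after division by `n`, so that tightness forces
`E (min W) = o(n)` (`sum_workload_le` makes both estimates explicit). This covers the critical load
as well as overload.

The means of the order statistics come from the layer cake formula: with `N t` tasks finished at
time `t`, the balance equation `P(N t ≤ q)' = -μ (k - q) P(N t = q)` gives
`∫ P(N t = q) dt = 1 / (μ (k - q))`, and `X_(i:k) > t` means `N t < i`, whence
`E X_(i:k) = (H_k - H_(k-i)) / μ`. Both utilizations are multiples of the arrival rate.
-/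

/-! ### Order statistics -/

theorem orderStat_eq_sort {n : ℕ} (x : Fin n → ℝ) (i : Fin n) :
    orderStat x (i + 1) = x (Tuple.sort x i) := by
  have h : {t : ℝ | (i : ℕ) + 1 ≤ (Finset.univ.filter fun j => x j ≤ t).card} =
      Ici (x (Tuple.sort x i)) := by
    ext t
    have h1 := Tuple.lt_card_le_iff_apply_le_of_monotone (f := x ∘ Tuple.sort x) (a := t) (j := i)
      (Tuple.monotone_sort x)
    have h2 : (Finset.univ.filter fun j => (x ∘ Tuple.sort x) j ≤ t).card =
        (Finset.univ.filter fun j => x j ≤ t).card := by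
      refine Finset.card_equiv (Tuple.sort x) fun j => ?_
      simp
    rw [h2] at h1
    exact h1
  rw [orderStat, h, csInf_Ici]

theorem orderStat_le_iff {n : ℕ} (x : Fin n → ℝ) {i : ℕ} (hi : 1 ≤ i) (hin : i ≤ n) (t : ℝ) :
    orderStat x i ≤ t ↔ i ≤ (Finset.univ.filter fun j => x j ≤ t).card := by
  obtain ⟨i, rfl⟩ : ∃ j, i = j + 1 := ⟨i - 1, by omega⟩
  have h1 := Tuple.lt_card_le_iff_apply_le_of_monotone (f := x ∘ Tuple.sort x) (a := t)
    (j := ⟨i, hin⟩) (Tuple.monotone_sort x)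
  have h2 : (Finset.univ.filter fun j => (x ∘ Tuple.sort x) j ≤ t).card =
      (Finset.univ.filter fun j => x j ≤ t).card := by
    refine Finset.card_equiv (Tuple.sort x) fun j => ?_
    simp
  rw [h2] at h1
  rw [orderStat_eq_sort x ⟨i, hin⟩]
  exact h1.symm

theorem exists_orderStat_eq {n : ℕ} (x : Fin n → ℝ) {i : ℕ} (hi : 1 ≤ i) (hin : i ≤ n) :
    ∃ j, orderStat x i = x j := by
  obtain ⟨i, rfl⟩ : ∃ j, i = j + 1 := ⟨i - 1, by omega⟩
  exact ⟨_, orderStat_eq_sort x ⟨i, hin⟩⟩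

theorem measurable_orderStat {n : ℕ} {i : ℕ} (hi : 1 ≤ i) (hin : i ≤ n) :
    Measurable fun x : Fin n → ℝ => orderStat x i := by
  refine measurable_of_Iic fun t => ?_
  have : (fun x : Fin n → ℝ => orderStat x i) ⁻¹' Iic t =
      {x | i ≤ ∑ j, if x j ≤ t then 1 else 0} := by
    ext x
    rw [mem_preimage, mem_Iic, orderStat_le_iff x hi hin t, Finset.card_filter, mem_ofPred_eq]
  rw [this]
  refine measurableSet_le measurable_const ?_
  refine Finset.measurable_sum _ fun j _ => ?_
  exact Measurable.ite (measurableSet_le (measurable_pi_apply j) measurable_const)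
    measurable_const measurable_const

/-! ### The Kiefer–Wolfowitz recursion -/

section KieferWolfowitz

variable {m : ℕ}

/-- Server `i` is the one of smallest index among the servers with the least workload. -/
def IsLeastLoaded (x : Fin m → ℝ) (i : Fin m) : Prop := (∀ j, x i ≤ x j) ∧ ∀ j < i, x i < x j

theorem exists_isLeastLoaded [NeZero m] (x : Fin m → ℝ) : ∃ i, IsLeastLoaded x i := by
  classical
  obtain ⟨i₀, hi₀⟩ := Finite.exists_min x
  let A : Finset (Fin m) := Finset.univ.filter fun i => ∀ j, x i ≤ x j
  have hA : A.Nonempty := ⟨i₀, by simpa [A] using hi₀⟩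
  have h := A.min'_mem hA
  simp only [A, Finset.mem_filter, Finset.mem_univ, true_and] at h
  refine ⟨A.min' hA, h, fun j hj => lt_of_not_ge fun hle => ?_⟩
  exact absurd (A.min'_le j (by simpa [A] using fun q => hle.trans (h q))) (not_le.2 hj)

theorem IsLeastLoaded.eq {x : Fin m → ℝ} {i j : Fin m} (hi : IsLeastLoaded x i)
    (hj : IsLeastLoaded x j) : i = j := by
  rcases lt_trichotomy i j with h | h | h
  · exact absurd (hj.2 i h) (not_lt.2 (hi.1 j))
  · exact h
  · exact absurd (hi.2 j h) (not_lt.2 (hj.1 i))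

theorem IsLeastLoaded.iInf_eq {x : Fin m → ℝ} {i : Fin m} (hi : IsLeastLoaded x i) :
    ⨅ j, x j = x i :=
  haveI : Nonempty (Fin m) := ⟨i⟩
  le_antisymm (ciInf_le (Finite.bddBelow_range x) i) (le_ciInf hi.1)

open Classical in
/-- The server workloads after a job with service requirement `b` has joined the least loaded
server. -/
noncomputable def addJob (x : Fin m → ℝ) (b : ℝ) : Fin m → ℝ :=
  fun i => if IsLeastLoaded x i then x i + b else x i

/-- The workloads found at the arrival times of the successive jobs of an `m`-server
first-come-first-served queue that starts empty: job `n` needs service `σ n`, and arrives the time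
`τ n` after job `n - 1`. -/
noncomputable def workload (σ τ : ℕ → ℝ) : ℕ → Fin m → ℝ
  | 0 => 0
  | n + 1 => fun i => max 0 (addJob (workload σ τ n) (σ n) i - τ (n + 1))

/-- The delay (waiting plus service time) of job `n` in the `m`-server queue. -/
noncomputable def delay (m : ℕ) (σ τ : ℕ → ℝ) (n : ℕ) : ℝ :=
  (⨅ i, workload (m := m) σ τ n i) + σ n

theorem addJob_eq_update {x : Fin m → ℝ} {i : Fin m} (hi : IsLeastLoaded x i) (b : ℝ) :
    addJob x b = Function.update x i (x i + b) := by
  funext j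
  by_cases h : j = i
  · subst h; simp [addJob, hi]
  · have : ¬ IsLeastLoaded x j := fun hj => h (hj.eq hi)
    simp [addJob, this, h]

theorem sum_addJob {x : Fin m → ℝ} {i : Fin m} (hi : IsLeastLoaded x i) (b : ℝ) (f : ℝ → ℝ) :
    ∑ j, f (addJob x b j) = ∑ j, f (x j) - f (x i) + f (x i + b) := by
  rw [addJob_eq_update hi, ← Finset.add_sum_erase _ _ (Finset.mem_univ i),
    ← Finset.add_sum_erase (a := i) _ (fun j => f (x j)) (Finset.mem_univ i)]
  have : ∑ j ∈ Finset.univ.erase i, f (Function.update x i (x i + b) j) =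
      ∑ j ∈ Finset.univ.erase i, f (x j) :=
    Finset.sum_congr rfl fun j hj => by rw [Function.update_of_ne (Finset.ne_of_mem_erase hj)]
  rw [this, Function.update_self]
  ring

theorem workload_nonneg (σ τ : ℕ → ℝ) (n : ℕ) (i : Fin m) : 0 ≤ workload σ τ n i := by
  cases n with
  | zero => exact le_rfl
  | succ n => exact le_max_left _ _

theorem iInf_workload_nonneg (σ τ : ℕ → ℝ) (n : ℕ) : 0 ≤ ⨅ i : Fin m, workload σ τ n i :=
  Real.iInf_nonneg fun i => workload_nonneg σ τ n i

theorem workload_congr {σ τ σ' τ' : ℕ → ℝ} (n : ℕ) (hσ : ∀ j < n, σ j = σ' j)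
    (hτ : ∀ j < n, τ (j + 1) = τ' (j + 1)) :
    workload (m := m) σ τ n = workload σ' τ' n := by
  induction n with
  | zero => rfl
  | succ n ih =>
    simp only [workload]
    rw [ih (fun j hj => hσ j (by omega)) fun j hj => hτ j (by omega), hσ n (by omega),
      hτ n (by omega)]

theorem delay_congr {σ τ σ' τ' : ℕ → ℝ} (n : ℕ) (hσ : ∀ j ≤ n, σ j = σ' j)
    (hτ : ∀ j < n, τ (j + 1) = τ' (j + 1)) : delay m σ τ n = delay m σ' τ' n := by
  rw [delay, delay, workload_congr n (fun j hj => hσ j hj.le) hτ, hσ n le_rfl]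

/-- Adding a job to the least loaded server is monotone for the comparison of workload vectors up
to a permutation of the servers. -/
theorem exists_perm_addJob_le [NeZero m] {x y : Fin m → ℝ} (π : Equiv.Perm (Fin m))
    (h : ∀ i, x i ≤ y (π i)) (b : ℝ) :
    ∃ π' : Equiv.Perm (Fin m), ∀ i, addJob x b i ≤ addJob y b (π' i) := by
  obtain ⟨i₀, hi₀⟩ := exists_isLeastLoaded x
  obtain ⟨j₀, hj₀⟩ := exists_isLeastLoaded y
  -- `π'` is `π` with two values exchanged, so that the two least loaded servers correspond
  set i₁ := π.symm j₀ with hi₁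
  have hπ : π i₁ = j₀ := by simp [i₁]
  rw [addJob_eq_update hi₀, addJob_eq_update hj₀]
  refine ⟨(Equiv.swap i₀ i₁).trans π, fun i => ?_⟩
  have h01 : x i₀ ≤ y j₀ := (hi₀.1 i₁).trans (hπ ▸ h i₁)
  by_cases hi : i = i₀
  · subst hi
    simpa [hπ] using h01
  rw [Function.update_of_ne hi]
  by_cases hi' : i = i₁
  · subst hi'
    have hne : π i₀ ≠ j₀ := fun h' => hi (π.injective (hπ.trans h'.symm))
    simp only [Equiv.trans_apply, Equiv.swap_apply_right]
    rw [Function.update_of_ne hne]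
    exact (hπ ▸ h i₁).trans (hj₀.1 _)
  · have hne : π i ≠ j₀ := fun h' => hi' (π.injective (h'.trans hπ.symm))
    simp only [Equiv.trans_apply, Equiv.swap_apply_of_ne_of_ne hi hi']
    rw [Function.update_of_ne hne]
    exact h i

/-- Loynes' comparison: without its first job, the queue is less loaded. -/
theorem exists_perm_workload_shift_le [NeZero m] (σ τ : ℕ → ℝ) (n : ℕ) :
    ∃ π : Equiv.Perm (Fin m), ∀ i,
      workload (fun j => σ (j + 1)) (fun j => τ (j + 1)) n i ≤ workload σ τ (n + 1) (π i) := by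
  induction n with
  | zero => exact ⟨1, fun i => workload_nonneg σ τ 1 _⟩
  | succ n ih =>
    obtain ⟨π, hπ⟩ := ih
    obtain ⟨π', hπ'⟩ := exists_perm_addJob_le π hπ (σ (n + 1))
    refine ⟨π', fun i => ?_⟩
    rw [workload, workload.eq_2 σ τ (n + 1)]
    exact max_le_max le_rfl (sub_le_sub_right (hπ' i) _)

theorem delay_shift_le [NeZero m] (σ τ : ℕ → ℝ) (n : ℕ) :
    delay m (fun j => σ (j + 1)) (fun j => τ (j + 1)) n ≤ delay m σ τ (n + 1) := by
  obtain ⟨π, hπ⟩ := exists_perm_workload_shift_le (m := m) σ τ n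
  refine add_le_add ?_ le_rfl
  refine le_ciInf fun i => ?_
  have := hπ (π.symm i)
  rw [Equiv.apply_symm_apply] at this
  exact (ciInf_le (Finite.bddBelow_range _) _).trans this

theorem workload_le_sum {σ τ : ℕ → ℝ} (hσ : ∀ n, 0 ≤ σ n) (hτ : ∀ n, 0 ≤ τ n) (n : ℕ)
    (i : Fin m) : workload σ τ n i ≤ ∑ j ∈ Finset.range n, σ j := by
  induction n generalizing i with
  | zero => simp [workload]
  | succ n ih =>
    rw [workload, Finset.sum_range_succ]
    refine max_le (add_nonneg (Finset.sum_nonneg fun j _ => hσ j) (hσ n)) ?_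
    have h1 := ih i
    have h2 := hσ n
    have h3 := hτ (n + 1)
    unfold addJob
    split_ifs <;> linarith

/-- The workloads of two servers differ by at most the largest service requirement so far. -/
theorem workload_le_workload_add {σ τ : ℕ → ℝ} (hσ : ∀ n, 0 ≤ σ n) {n : ℕ} {r : ℝ} (hr : 0 ≤ r)
    (hσr : ∀ j < n, σ j ≤ r) (i j : Fin m) : workload σ τ n i ≤ workload σ τ n j + r := by
  induction n generalizing i j with
  | zero => simpa [workload] using hr
  | succ n ih =>
    have h0 := ih (fun q hq => hσr q (by omega))
    have key : addJob (workload σ τ n) (σ n) i ≤ addJob (workload σ τ n) (σ n) j + r := by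
      have h1 := h0 i j
      have h2 := hσr n (by omega)
      have h3 := hσ n
      unfold addJob
      by_cases hi : IsLeastLoaded (workload σ τ n) i
      · have h4 := hi.1 j
        split_ifs <;> linarith
      · split_ifs <;> linarith
    simp only [workload]
    refine max_le (add_nonneg (le_max_left _ _) hr) ?_
    have := le_max_right 0 (addJob (workload σ τ n) (σ n) j - τ (n + 1))
    linarith

end KieferWolfowitz

/-! ### Reduction of the barrier system to an ordinary multi-server queue -/

theorem iInf_eq_of_sort_symm_lt {s m k : ℕ} [NeZero m] {x : Fin s → ℝ} {g : ℝ → ℝ}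
    (hg : Monotone g) {u : Fin m → ℝ} (h : ∀ f : ℝ → ℝ, ∑ w, f (g (x w)) = k * ∑ i, f (u i))
    {w : Fin s} (hw : ((Tuple.sort x).symm w : ℕ) < k) : g (x w) = ⨅ i, u i := by
  classical
  set c := ⨅ i, u i with hc
  have hcu : ∀ i, c ≤ u i := fun i => ciInf_le (Finite.bddBelow_range u) i
  refine le_antisymm ?_ ?_
  · have h1 := h fun t => if t ≤ c then 1 else 0
    obtain ⟨i₀, hi₀⟩ := exists_eq_ciInf_of_finite (f := u)
    have h2 : (1 : ℝ) ≤ ∑ i, if u i ≤ c then 1 else 0 := by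
      refine le_trans ?_ (Finset.single_le_sum (f := fun i => if u i ≤ c then (1 : ℝ) else 0)
        (fun i _ => by positivity) (Finset.mem_univ i₀))
      simp [hi₀, hc]
    have h3 : k ≤ (Finset.univ.filter fun w => g (x w) ≤ c).card := by
      have : (k : ℝ) ≤ ∑ w, if g (x w) ≤ c then 1 else 0 := by rw [h1]; nlinarith
      rw [Finset.sum_boole] at this
      exact_mod_cast this
    have h4 : (Finset.univ.filter fun j => (g ∘ x ∘ Tuple.sort x) j ≤ c).card =
        (Finset.univ.filter fun j => g (x j) ≤ c).card := by
      refine Finset.card_equiv (Tuple.sort x) fun j => ?_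
      simp
    have h5 := (Tuple.lt_card_le_iff_apply_le_of_monotone (f := g ∘ x ∘ Tuple.sort x) (a := c)
      (j := (Tuple.sort x).symm w) (hg.comp (Tuple.monotone_sort x))).1
      (by rw [h4]; exact hw.trans_le h3)
    simpa using h5
  · have h1 := h fun t => if t < c then 1 else 0
    have h2 : ∑ i, (if u i < c then (1 : ℝ) else 0) = 0 :=
      Finset.sum_eq_zero fun i _ => by rw [if_neg (not_lt.2 (hcu i))]
    rw [h2, mul_zero, Finset.sum_eq_zero_iff_of_nonneg fun i _ => by positivity] at h1
    by_contra hlt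
    simpa [not_le.1 hlt] using h1 w (Finset.mem_univ w)

theorem card_filter_sort_symm_lt {s k : ℕ} (hks : k ≤ s) (π : Equiv.Perm (Fin s)) :
    (Finset.univ.filter fun w => (π.symm w : ℕ) < k).card = k := by
  have h : (Finset.univ.filter fun w => (π.symm w : ℕ) < k).card =
      (Finset.univ.filter fun p : Fin s => (p : ℕ) < k).card :=
    Finset.card_equiv π.symm fun j => by simp
  rw [h, Fin.card_filter_val_lt, min_eq_right hks]

/-- When `k` divides the number of workers, the workers always come in groups of `k` that become
available in unison: the workloads of the workers are `k` copies of those of the servers of an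
ordinary queue with `m = s / k` servers. Equality of the two multisets is expressed by sums of
arbitrary functions. -/
theorem sum_workerFree_eq {s m k : ℕ} [NeZero m] (hs : s = k * m) (hk : 0 < k) {a σ τ : ℕ → ℝ}
    (ha0 : 0 ≤ a 0) (ha : ∀ n, a (n + 1) = a n + τ (n + 1)) (hσ : ∀ n, 0 ≤ σ n)
    (hτ : ∀ n, 0 ≤ τ n) (n : ℕ) :
    ∀ f : ℝ → ℝ, ∑ w, f (max (a n) (workerFree (s := s) a σ k n w) - a n) =
      k * ∑ i : Fin m, f (workload σ τ n i) := by
  have hks : k ≤ s := hs ▸ Nat.le_mul_of_pos_right k (NeZero.pos m)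
  induction n with
  | zero =>
    intro f
    simp [workerFree, workload, ha0, hs]
    ring
  | succ n ih =>
    intro f
    set V := workerFree (s := s) a σ k n with hV
    set u : Fin m → ℝ := workload σ τ n with hu
    have hg : Monotone fun t => max (a n) t - a n := fun t t' h =>
      sub_le_sub_right (max_le_max le_rfl h) _
    have hmin : ∀ w, ((Tuple.sort V).symm w : ℕ) < k → max (a n) (V w) - a n = ⨅ i, u i :=
      fun w hw => iInf_eq_of_sort_symm_lt hg ih hw
    have hord : max (a n) (orderStat V k) - a n = ⨅ i, u i := by
      obtain ⟨k', rfl⟩ : ∃ j, k = j + 1 := ⟨k - 1, by omega⟩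
      rw [orderStat_eq_sort V ⟨k', hks⟩]
      exact hmin _ (by simp)
    obtain ⟨i₀, hi₀⟩ := exists_isLeastLoaded u
    rw [hi₀.iInf_eq] at hmin hord
    set F : ℝ → ℝ := fun t => f (max 0 (t - τ (n + 1))) with hF
    have h1 : ∀ v, max (a n + τ (n + 1)) v - (a n + τ (n + 1)) =
        max 0 (max (a n) v - a n - τ (n + 1)) := by
      intro v
      have := hτ (n + 1)
      rcases max_cases (a n + τ (n + 1)) v with h | h <;>
      rcases max_cases (a n) v with h' | h' <;>
      rcases max_cases 0 (max (a n) v - a n - τ (n + 1)) with h'' | h'' <;> linarith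
    have h2 : ∀ w, f (max (a (n + 1)) (workerFree (s := s) a σ k (n + 1) w) - a (n + 1)) =
        F (max (a n) (V w) - a n) + if ((Tuple.sort V).symm w : ℕ) < k then
          F (u i₀ + σ n) - F (u i₀) else 0 := by
      intro w
      have h3 : workerFree (s := s) a σ k (n + 1) w =
          if ((Tuple.sort V).symm w : ℕ) < k then
            max (a n) (orderStat V k) + σ n else V w := rfl
      rw [ha, h1, h3]
      by_cases hw : ((Tuple.sort V).symm w : ℕ) < k
      · have h4 : max (a n) (max (a n) (orderStat V k) + σ n) - a n = u i₀ + σ n := by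
          rw [max_eq_right ((le_max_left _ _).trans (le_add_of_nonneg_right (hσ n)))]
          linarith
        rw [if_pos hw, if_pos hw, hmin w hw, h4]
        simp [F]
      · rw [if_neg hw, if_neg hw, add_zero]
    rw [Finset.sum_congr rfl fun w _ => h2 w, Finset.sum_add_distrib, ih F, ← Finset.sum_filter,
      Finset.sum_const, card_filter_sort_symm_lt hks, nsmul_eq_mul]
    have h5 : ∑ i, f (workload σ τ (n + 1) i) = ∑ i, F (addJob u (σ n) i) := rfl
    rw [h5, sum_addJob hi₀]
    ring

/-- The sojourn times of the barrier system are the delays in an ordinary queue with `m = s / k`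
servers. -/
theorem jobStart_add_sub_eq_delay {s m k : ℕ} [NeZero m] (hs : s = k * m) (hk : 0 < k)
    {a σ τ : ℕ → ℝ} (ha0 : 0 ≤ a 0) (ha : ∀ n, a (n + 1) = a n + τ (n + 1))
    (hσ : ∀ n, 0 ≤ σ n) (hτ : ∀ n, 0 ≤ τ n) (n : ℕ) :
    jobStart s a σ k n + σ n - a n = delay m σ τ n := by
  have hks : k ≤ s := hs ▸ Nat.le_mul_of_pos_right k (NeZero.pos m)
  have hg : Monotone fun t => max (a n) t - a n := fun t t' h =>
    sub_le_sub_right (max_le_max le_rfl h) _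
  have hord : max (a n) (orderStat (workerFree (s := s) a σ k n) k) - a n =
      ⨅ i : Fin m, workload σ τ n i := by
    obtain ⟨k', rfl⟩ : ∃ j, k = j + 1 := ⟨k - 1, by omega⟩
    rw [orderStat_eq_sort _ ⟨k', hks⟩]
    exact iInf_eq_of_sort_symm_lt hg (sum_workerFree_eq hs hk ha0 ha hσ hτ n) (by simp)
  rw [delay, ← hord, jobStart]
  ring

/-! ### The queue with independent random input -/

theorem measurableSet_isLeastLoaded {Ω : Type*} [MeasurableSpace Ω] {m : ℕ} {X : Ω → Fin m → ℝ}
    (hX : ∀ i, Measurable fun ω => X ω i) (i : Fin m) :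
    MeasurableSet {ω | IsLeastLoaded (X ω) i} := by
  have : {ω | IsLeastLoaded (X ω) i} =
      (⋂ j, {ω | X ω i ≤ X ω j}) ∩ ⋂ j, ⋂ _ : j < i, {ω | X ω i < X ω j} := by
    ext ω
    simp [IsLeastLoaded]
  rw [this]
  exact (MeasurableSet.iInter fun j => measurableSet_le (hX i) (hX j)).inter
    (MeasurableSet.iInter fun j => MeasurableSet.iInter fun _ => measurableSet_lt (hX i) (hX j))

/-- The workloads found by job `n` are functions of the service requirements of the earlier jobs
and of the inter-arrival times up to job `n`. The σ-algebra on `Ω` is arbitrary here, so that the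
lemma also expresses adaptedness. -/
theorem measurable_workload {Ω : Type*} [MeasurableSpace Ω] {m : ℕ} {σ τ : ℕ → Ω → ℝ} {n : ℕ}
    (hσ : ∀ j < n, Measurable (σ j)) (hτ : ∀ j < n, Measurable (τ (j + 1))) (i : Fin m) :
    Measurable fun ω => workload (σ · ω) (τ · ω) n i := by
  induction n generalizing i with
  | zero => exact measurable_const
  | succ n ih =>
    have h := ih (fun j hj => hσ j (by omega)) fun j hj => hτ j (by omega)
    refine Measurable.max measurable_const (Measurable.sub ?_ (hτ n (by omega)))
    exact Measurable.ite (measurableSet_isLeastLoaded h i) ((h i).add (hσ n (by omega))) (h i)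

theorem measurable_iInf_workload {Ω : Type*} [MeasurableSpace Ω] {m : ℕ} {σ τ : ℕ → Ω → ℝ} {n : ℕ}
    (hσ : ∀ j < n, Measurable (σ j)) (hτ : ∀ j < n, Measurable (τ (j + 1))) :
    Measurable fun ω => ⨅ i : Fin m, workload (σ · ω) (τ · ω) n i :=
  Measurable.iInf fun i => measurable_workload hσ hτ i

theorem measurable_delay {Ω : Type*} [MeasurableSpace Ω] {m : ℕ} {σ τ : ℕ → Ω → ℝ} {n : ℕ}
    (hσ : ∀ j ≤ n, Measurable (σ j)) (hτ : ∀ j < n, Measurable (τ (j + 1))) :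
    Measurable fun ω => delay m (σ · ω) (τ · ω) n :=
  (measurable_iInf_workload (fun j hj => hσ j hj.le) hτ).add (hσ n le_rfl)

/-- Two functions of disjoint subfamilies of a family of independent variables are independent. -/
theorem indepFun_of_measurable_iSup {Ω ι : Type*} [MeasurableSpace Ω] {P : Measure Ω}
    {Z : ι → Ω → ℝ} (hZ : iIndepFun Z P) (hm : ∀ j, Measurable (Z j)) {A B : Set ι}
    (hAB : Disjoint A B) {f g : Ω → ℝ}
    (hf : Measurable[⨆ j ∈ A, MeasurableSpace.comap (Z j) inferInstance] f)
    (hg : Measurable[⨆ j ∈ B, MeasurableSpace.comap (Z j) inferInstance] g) :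
    IndepFun f g P := by
  have h := indep_iSup_of_disjoint (fun j => (hm j).comap_le) hZ.iIndep hAB
  exact indep_of_indep_of_le_left (indep_of_indep_of_le_right h hg.comap_le) hf.comap_le

theorem measurable_iSup_comap {Ω ι : Type*} {Z : ι → Ω → ℝ} {A : Set ι} {j : ι} (hj : j ∈ A) :
    Measurable[⨆ j ∈ A, MeasurableSpace.comap (Z j) inferInstance] (Z j) :=
  Measurable.mono (comap_measurable (Z j))
    (le_iSup₂ (f := fun j (_ : j ∈ A) => MeasurableSpace.comap (Z j) inferInstance) j hj) le_rfl

/-- Functions of pairwise disjoint subfamilies of a family of independent variables are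
independent. -/
theorem iIndepFun_of_disjoint_blocks {Ω ι κ : Type*} [MeasurableSpace Ω] {P : Measure Ω}
    [IsProbabilityMeasure P] {Z : ι → Ω → ℝ} (hZ : iIndepFun Z P) (hm : ∀ j, Measurable (Z j))
    {B : κ → Set ι} (hB : Pairwise fun a b => Disjoint (B a) (B b)) {Y : κ → Ω → ℝ}
    (hY : ∀ a, Measurable[⨆ j ∈ B a, MeasurableSpace.comap (Z j) inferInstance] (Y a)) :
    iIndepFun Y P := by
  classical
  rw [iIndepFun_iff_measure_inter_preimage_eq_mul]
  intro S A hA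
  induction S using Finset.induction_on with
  | empty => simp
  | insert a S ha ih =>
    have hdis : Disjoint (B a) (⋃ b ∈ S, B b) := by
      simp only [disjoint_iUnion_right]
      exact fun b hb => hB fun h => ha (h ▸ hb)
    have h := indep_iSup_of_disjoint (fun j => (hm j).comap_le) hZ.iIndep hdis
    have h1 := hY a (hA a (Finset.mem_insert_self a S))
    have h2 : MeasurableSet[⨆ j ∈ ⋃ b ∈ S, B b, MeasurableSpace.comap (Z j) inferInstance]
        (⋂ b ∈ S, Y b ⁻¹' A b) := by
      refine MeasurableSet.biInter S.countable_toSet fun b hb => ?_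
      have h3 : (⨆ j ∈ B b, MeasurableSpace.comap (Z j) inferInstance) ≤
          ⨆ j ∈ ⋃ b ∈ S, B b, MeasurableSpace.comap (Z j) inferInstance :=
        biSup_mono fun j hj => mem_biUnion hb hj
      exact h3 _ (hY b (hA b (Finset.mem_insert_of_mem hb)))
    rw [Finset.set_biInter_insert, (Indep_iff _ _ P).1 h _ _ h1 h2, Finset.prod_insert ha,
      ih fun b hb => hA b (Finset.mem_insert_of_mem hb)]

/-- The random input of a GI/GI queue: the inter-arrival times `τ n` and the service requirements
`σ n` are independent, non-negative and square integrable, each of the two sequences being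
identically distributed. -/
structure IsQueueInput {Ω : Type*} [MeasurableSpace Ω] (σ τ : ℕ → Ω → ℝ) (P : Measure Ω) :
    Prop where
  measurable_service : ∀ n, Measurable (σ n)
  measurable_interarrival : ∀ n, Measurable (τ n)
  indep : iIndepFun (Sum.elim τ σ) P
  law_service : ∀ n, P.map (σ n) = P.map (σ 0)
  law_interarrival : ∀ n, P.map (τ n) = P.map (τ 0)
  service_nonneg : ∀ n, ∀ᵐ ω ∂P, 0 ≤ σ n ω
  interarrival_nonneg : ∀ n, ∀ᵐ ω ∂P, 0 ≤ τ n ω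
  memLp_service : ∀ n, MemLp (σ n) 2 P
  memLp_interarrival : ∀ n, MemLp (τ n) 2 P

namespace IsQueueInput

variable {Ω : Type*} [MeasurableSpace Ω] {P : Measure Ω}
  {σ τ : ℕ → Ω → ℝ} {m : ℕ}

theorem measurable_elim (h : IsQueueInput σ τ P) (j : ℕ ⊕ ℕ) : Measurable (Sum.elim τ σ j) := by
  cases j
  · exact h.measurable_interarrival _
  · exact h.measurable_service _

theorem ae_nonneg (h : IsQueueInput σ τ P) : ∀ᵐ ω ∂P, (∀ n, 0 ≤ σ n ω) ∧ ∀ n, 0 ≤ τ n ω := by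
  filter_upwards [ae_all_iff.2 h.service_nonneg, ae_all_iff.2 h.interarrival_nonneg] with ω h1 h2
  exact ⟨h1, h2⟩

theorem integral_comp_service (h : IsQueueInput σ τ P) {f : ℝ → ℝ} (hf : Measurable f) (n : ℕ) :
    ∫ ω, f (σ n ω) ∂P = ∫ ω, f (σ 0 ω) ∂P :=
  ((IdentDistrib.mk (h.measurable_service n).aemeasurable (h.measurable_service 0).aemeasurable
    (h.law_service n)).comp hf).integral_eq

theorem integral_comp_interarrival (h : IsQueueInput σ τ P) {f : ℝ → ℝ} (hf : Measurable f)
    (n : ℕ) : ∫ ω, f (τ n ω) ∂P = ∫ ω, f (τ 0 ω) ∂P :=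
  ((IdentDistrib.mk (h.measurable_interarrival n).aemeasurable
    (h.measurable_interarrival 0).aemeasurable (h.law_interarrival n)).comp hf).integral_eq

theorem integral_service (h : IsQueueInput σ τ P) (n : ℕ) :
    ∫ ω, σ n ω ∂P = ∫ ω, σ 0 ω ∂P :=
  h.integral_comp_service measurable_id n

theorem integral_interarrival (h : IsQueueInput σ τ P) (n : ℕ) :
    ∫ ω, τ n ω ∂P = ∫ ω, τ 0 ω ∂P :=
  h.integral_comp_interarrival measurable_id n

/-- Relabelling the jobs injectively does not change the joint law of the input. -/
theorem map_reindex (h : IsQueueInput σ τ P) {φ : ℕ → ℕ} (hφ : φ.Injective) :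
    P.map (fun ω j => Sum.elim τ σ (Sum.map φ φ j) ω) = P.map (fun ω j => Sum.elim τ σ j ω) := by
  have h1 : iIndepFun (fun j => Sum.elim τ σ (Sum.map φ φ j)) P :=
    h.indep.precomp (Sum.map_injective.2 ⟨hφ, hφ⟩)
  rw [h1.map_fun_eq_infinitePi_map fun j => h.measurable_elim _,
    h.indep.map_fun_eq_infinitePi_map h.measurable_elim]
  congr 1
  funext j
  cases j with
  | inl n => simp [h.law_interarrival (φ n), h.law_interarrival n]
  | inr n => simp [h.law_service (φ n), h.law_service n]

theorem map_delay_reindex (h : IsQueueInput σ τ P) {φ : ℕ → ℕ} (hφ : φ.Injective) (m n : ℕ) :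
    P.map (fun ω => delay m (fun j => σ (φ j) ω) (fun j => τ (φ j) ω) n) =
      P.map fun ω => delay m (σ · ω) (τ · ω) n := by
  have hF : Measurable fun z : ℕ ⊕ ℕ → ℝ =>
      delay m (fun j => z (Sum.inr j)) (fun j => z (Sum.inl j)) n :=
    measurable_delay (σ := fun j (z : ℕ ⊕ ℕ → ℝ) => z (Sum.inr j))
      (τ := fun j (z : ℕ ⊕ ℕ → ℝ) => z (Sum.inl j)) (fun j _ => measurable_pi_apply _)
      fun j _ => measurable_pi_apply _
  have h1 := congrArg (Measure.map fun z : ℕ ⊕ ℕ → ℝ =>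
      delay m (fun j => z (Sum.inr j)) (fun j => z (Sum.inl j)) n) (h.map_reindex hφ)
  rw [Measure.map_map hF (measurable_pi_lambda _ fun j => h.measurable_elim _),
    Measure.map_map hF (measurable_pi_lambda _ fun j => h.measurable_elim _)] at h1
  exact h1

theorem measurable_workload (h : IsQueueInput σ τ P) (n : ℕ) (i : Fin m) :
    Measurable fun ω => workload (σ · ω) (τ · ω) n i :=
  _root_.measurable_workload (fun _ _ => h.measurable_service _)
    (fun _ _ => h.measurable_interarrival _) i

theorem measurable_delay (h : IsQueueInput σ τ P) (m n : ℕ) :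
    Measurable fun ω => delay m (σ · ω) (τ · ω) n :=
  _root_.measurable_delay (fun _ _ => h.measurable_service _)
    (fun _ _ => h.measurable_interarrival _)

theorem measurable_iInf_workload (h : IsQueueInput σ τ P) (m n : ℕ) :
    Measurable fun ω => ⨅ i : Fin m, workload (σ · ω) (τ · ω) n i :=
  Measurable.iInf fun i => h.measurable_workload n i

theorem memLp_workload (h : IsQueueInput σ τ P) (n : ℕ) (i : Fin m) :
    MemLp (fun ω => workload (σ · ω) (τ · ω) n i) 2 P := by
  have hs : MemLp (fun ω => ∑ j ∈ Finset.range n, σ j ω) 2 P :=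
    memLp_finsetSum _ fun j _ => h.memLp_service j
  refine hs.of_le (h.measurable_workload n i).aestronglyMeasurable ?_
  filter_upwards [h.ae_nonneg] with ω hω
  rw [Real.norm_of_nonneg (workload_nonneg _ _ _ _)]
  rw [Real.norm_eq_abs]
  exact (workload_le_sum hω.1 hω.2 n i).trans (le_abs_self _)

theorem memLp_iInf_workload [NeZero m] (h : IsQueueInput σ τ P) (n : ℕ) :
    MemLp (fun ω => ⨅ i : Fin m, workload (σ · ω) (τ · ω) n i) 2 P := by
  refine MemLp.of_le (h.memLp_workload (m := m) n 0)
    (h.measurable_iInf_workload m n).aestronglyMeasurable (ae_of_all _ fun ω => ?_)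
  rw [Real.norm_of_nonneg (iInf_workload_nonneg _ _ _),
    Real.norm_of_nonneg (workload_nonneg _ _ _ _)]
  exact ciInf_le (Finite.bddBelow_range _) _

theorem indepFun_iInf_workload_service (h : IsQueueInput σ τ P) (m n : ℕ) :
    IndepFun (fun ω => ⨅ i : Fin m, workload (σ · ω) (τ · ω) n i) (σ n) P := by
  refine indepFun_of_measurable_iSup h.indep h.measurable_elim
    (A := (Sum.inl '' Iic n ∪ Sum.inr '' Iio n : Set (ℕ ⊕ ℕ))) (B := {Sum.inr n})
    ?_ (@_root_.measurable_iInf_workload _ (_) _ _ _ _ (fun q hq => ?_) fun q hq => ?_)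
    (measurable_iSup_comap (Z := Sum.elim τ σ) (j := Sum.inr n) rfl)
  · simp
  · exact measurable_iSup_comap (Z := Sum.elim τ σ) (j := Sum.inr q) (Or.inr ⟨q, hq, rfl⟩)
  · exact measurable_iSup_comap (Z := Sum.elim τ σ) (j := Sum.inl (q + 1))
      (Or.inl ⟨q + 1, Nat.succ_le_of_lt hq, rfl⟩)

theorem indepFun_iInf_workload_interarrival (h : IsQueueInput σ τ P) (m n : ℕ) :
    IndepFun (fun ω => ⨅ i : Fin m, workload (σ · ω) (τ · ω) n i) (τ (n + 1)) P := by
  refine indepFun_of_measurable_iSup h.indep h.measurable_elim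
    (A := (Sum.inl '' Iic n ∪ Sum.inr '' Iio n : Set (ℕ ⊕ ℕ))) (B := {Sum.inl (n + 1)})
    ?_ (@_root_.measurable_iInf_workload _ (_) _ _ _ _ (fun q hq => ?_) fun q hq => ?_)
    (measurable_iSup_comap (Z := Sum.elim τ σ) (j := Sum.inl (n + 1)) rfl)
  · simp
  · exact measurable_iSup_comap (Z := Sum.elim τ σ) (j := Sum.inr q) (Or.inr ⟨q, hq, rfl⟩)
  · exact measurable_iSup_comap (Z := Sum.elim τ σ) (j := Sum.inl (q + 1))
      (Or.inl ⟨q + 1, Nat.succ_le_of_lt hq, rfl⟩)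

theorem indepFun_delay_interarrival (h : IsQueueInput σ τ P) (m n : ℕ) :
    IndepFun (fun ω => delay m (σ · ω) (τ · ω) n) (τ (n + 1)) P := by
  refine indepFun_of_measurable_iSup h.indep h.measurable_elim
    (A := (Sum.inl '' Iic n ∪ Sum.inr '' Iic n : Set (ℕ ⊕ ℕ))) (B := {Sum.inl (n + 1)})
    ?_ (@_root_.measurable_delay _ (_) _ _ _ _ (fun q hq => ?_) fun q hq => ?_)
    (measurable_iSup_comap (Z := Sum.elim τ σ) (j := Sum.inl (n + 1)) rfl)
  · simp
  · exact measurable_iSup_comap (Z := Sum.elim τ σ) (j := Sum.inr q) (Or.inr ⟨q, hq, rfl⟩)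
  · exact measurable_iSup_comap (Z := Sum.elim τ σ) (j := Sum.inl (q + 1))
      (Or.inl ⟨q + 1, Nat.succ_le_of_lt hq, rfl⟩)

variable [IsProbabilityMeasure P]

theorem integrable_delay [NeZero m] (h : IsQueueInput σ τ P) (n : ℕ) :
    Integrable (fun ω => delay m (σ · ω) (τ · ω) n) P :=
  ((h.memLp_iInf_workload n).add (h.memLp_service n)).integrable one_le_two

end IsQueueInput

/-! ### Stability below the critical load -/

/-- The jobs `0, …, n` in reverse order, as a permutation of `ℕ`. -/
def reverseUpTo (n j : ℕ) : ℕ := if j ≤ n then n - j else j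

theorem injective_reverseUpTo (n : ℕ) : (reverseUpTo n).Injective := by
  intro i j h
  unfold reverseUpTo at h
  split_ifs at h <;> omega

/-- The delay of the last of `n + 1` jobs, when the input is read backwards; Loynes' variable. -/
noncomputable def reversedDelay (m : ℕ) (σ τ : ℕ → ℝ) (n : ℕ) : ℝ :=
  delay m (fun j => σ (reverseUpTo n j)) (fun j => τ (reverseUpTo n j)) n

theorem monotone_reversedDelay (m : ℕ) [NeZero m] (σ τ : ℕ → ℝ) :
    Monotone (reversedDelay m σ τ) := by
  refine monotone_nat_of_le_succ fun n => ?_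
  refine le_trans (le_of_eq ?_) (delay_shift_le _ _ n)
  refine delay_congr n (fun j hj => ?_) fun j hj => ?_
  · have : reverseUpTo n j = reverseUpTo (n + 1) (j + 1) := by
      unfold reverseUpTo; split_ifs <;> omega
    simp only [this]
  · have : reverseUpTo n (j + 1) = reverseUpTo (n + 1) (j + 1 + 1) := by
      unfold reverseUpTo; split_ifs <;> omega
    simp only [this]

/-- One step of the quadratic Lyapunov function `∑ i, W i ^ 2`. -/
theorem sum_sq_workload_succ_le {m : ℕ} [NeZero m] {σ τ : ℕ → ℝ} (hσ : ∀ n, 0 ≤ σ n)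
    (hτ : ∀ n, 0 ≤ τ n) (n : ℕ) :
    ∑ i : Fin m, workload σ τ (n + 1) i ^ 2 ≤ ∑ i : Fin m, workload σ τ n i ^ 2 +
      2 * ((⨅ i : Fin m, workload σ τ n i) * σ n) -
      2 * m * ((⨅ i : Fin m, workload σ τ n i) * τ (n + 1)) + σ n ^ 2 + m * τ (n + 1) ^ 2 := by
  obtain ⟨i₀, hi₀⟩ := exists_isLeastLoaded (workload (m := m) σ τ n)
  rw [hi₀.iInf_eq]
  set u : Fin m → ℝ := workload σ τ n with hu
  have h1 : ∑ i : Fin m, workload σ τ (n + 1) i ^ 2 ≤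
      ∑ i : Fin m, (addJob u (σ n) i - τ (n + 1)) ^ 2 := by
    refine Finset.sum_le_sum fun i _ => ?_
    simp only [workload, ← hu]
    rcases max_cases 0 (addJob u (σ n) i - τ (n + 1)) with h | h <;> rw [h.1]
    nlinarith [sq_nonneg (addJob u (σ n) i - τ (n + 1))]
  rw [sum_addJob hi₀ (σ n) fun t => (t - τ (n + 1)) ^ 2] at h1
  have h2 : ∑ i, (u i - τ (n + 1)) ^ 2 =
      ∑ i, u i ^ 2 - 2 * τ (n + 1) * ∑ i, u i + m * τ (n + 1) ^ 2 := by
    have : ∀ i, (u i - τ (n + 1)) ^ 2 = u i ^ 2 - 2 * τ (n + 1) * u i + τ (n + 1) ^ 2 :=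
      fun i => by ring
    simp only [this, Finset.sum_add_distrib, Finset.sum_sub_distrib, ← Finset.mul_sum,
      Finset.sum_const, Finset.card_univ, Fintype.card_fin, nsmul_eq_mul]
  have h3 : m * u i₀ ≤ ∑ i, u i := by
    have := Finset.card_nsmul_le_sum Finset.univ u (u i₀) fun i _ => hi₀.1 i
    simpa using this
  have h4 := mul_nonneg (hτ (n + 1)) (sub_nonneg.2 h3)
  have h5 := mul_nonneg (hτ (n + 1)) (hσ n)
  rw [h2] at h1
  nlinarith

theorem MeasureTheory.TendstoInDistribution.congr_map {Ω Ω' : Type*} [MeasurableSpace Ω]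
    [MeasurableSpace Ω'] {P : Measure Ω} [IsProbabilityMeasure P] {Q : Measure Ω'}
    [IsProbabilityMeasure Q] {X Y : ℕ → Ω → ℝ} {Z : Ω' → ℝ}
    (h : TendstoInDistribution X atTop Z (fun _ => P) Q) (hY : ∀ n, AEMeasurable (Y n) P)
    (hXY : ∀ n, P.map (X n) = P.map (Y n)) :
    TendstoInDistribution Y atTop Z (fun _ => P) Q where
  forall_aemeasurable := hY
  aemeasurable_limit := h.aemeasurable_limit
  tendsto := by
    refine Tendsto.congr (fun n => ?_) h.tendsto
    exact Subtype.ext (hXY n)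

/-- A monotone sequence of random variables with bounded means converges in distribution. -/
theorem exists_tendstoInDistribution_of_monotone {Ω : Type*} [MeasurableSpace Ω] {P : Measure Ω}
    [IsProbabilityMeasure P] {X : ℕ → Ω → ℝ} (hX : ∀ n, Measurable (X n))
    (hmono : ∀ ω, Monotone fun n => X n ω) (hnonneg : ∀ n, 0 ≤ᵐ[P] X n)
    (hint : ∀ n, Integrable (X n) P) {C : ℝ} (hC : ∀ n, ∫ ω, X n ω ∂P ≤ C) :
    ∃ Z : Ω → ℝ, TendstoInDistribution X atTop Z (fun _ => P) P := by
  refine ⟨fun ω => ⨆ n, X n ω, tendstoInDistribution_of_ae_tendsto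
    (fun n => (hX n).aemeasurable) (Measurable.iSup hX).aemeasurable ?_⟩
  have h1 : ∫⁻ ω, ⨆ n, ENNReal.ofReal (X n ω) ∂P ≤ ENNReal.ofReal C := by
    rw [lintegral_iSup (fun n => (hX n).ennreal_ofReal)
      fun i j hij ω => ENNReal.ofReal_le_ofReal (hmono ω hij)]
    refine iSup_le fun n => ?_
    rw [← ofReal_integral_eq_lintegral_ofReal (hint n) (hnonneg n)]
    exact ENNReal.ofReal_le_ofReal (hC n)
  have h2 := ae_lt_top (Measurable.iSup fun n => (hX n).ennreal_ofReal)
    (h1.trans_lt ENNReal.ofReal_lt_top).ne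
  filter_upwards [h2] with ω hω
  refine tendsto_atTop_ciSup (hmono ω) ⟨(⨆ n, ENNReal.ofReal (X n ω)).toReal, ?_⟩
  rintro _ ⟨n, rfl⟩
  exact (ENNReal.ofReal_le_iff_le_toReal hω.ne).1
    (le_iSup (fun n => ENNReal.ofReal (X n ω)) n)

namespace IsQueueInput

variable {Ω : Type*} [MeasurableSpace Ω] {P : Measure Ω}
  {σ τ : ℕ → Ω → ℝ} {m : ℕ}

theorem map_reversedDelay (h : IsQueueInput σ τ P) (m n : ℕ) :
    P.map (fun ω => reversedDelay m (σ · ω) (τ · ω) n) =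
      P.map fun ω => delay m (σ · ω) (τ · ω) n :=
  h.map_delay_reindex (injective_reverseUpTo n) m n

theorem measurable_reversedDelay (h : IsQueueInput σ τ P) (m n : ℕ) :
    Measurable fun ω => reversedDelay m (σ · ω) (τ · ω) n :=
  _root_.measurable_delay (σ := fun j => σ (reverseUpTo n j)) (τ := fun j => τ (reverseUpTo n j))
    (fun _ _ => h.measurable_service _) fun _ _ => h.measurable_interarrival _

theorem identDistrib_reversedDelay (h : IsQueueInput σ τ P) (m n : ℕ) :
    IdentDistrib (fun ω => delay m (σ · ω) (τ · ω) n)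
      (fun ω => reversedDelay m (σ · ω) (τ · ω) n) P P :=
  ⟨(h.measurable_delay m n).aemeasurable, (h.measurable_reversedDelay m n).aemeasurable,
    (h.map_reversedDelay m n).symm⟩

variable [NeZero m]

/-- The drift of the expected quadratic Lyapunov function. -/
theorem integral_sum_sq_workload_succ_le (h : IsQueueInput σ τ P) (n : ℕ) :
    ∫ ω, ∑ i : Fin m, workload (σ · ω) (τ · ω) (n + 1) i ^ 2 ∂P ≤
      ∫ ω, ∑ i : Fin m, workload (σ · ω) (τ · ω) n i ^ 2 ∂P -
      2 * (m * ∫ ω, τ 0 ω ∂P - ∫ ω, σ 0 ω ∂P) *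
        ∫ ω, ⨅ i : Fin m, workload (σ · ω) (τ · ω) n i ∂P +
      (∫ ω, σ 0 ω ^ 2 ∂P + m * ∫ ω, τ 0 ω ^ 2 ∂P) := by
  have hΦ : ∀ n, Integrable (fun ω => ∑ i : Fin m, workload (σ · ω) (τ · ω) n i ^ 2) P :=
    fun n => integrable_finsetSum _ fun i _ => (h.memLp_workload n i).integrable_sq
  have hw := h.memLp_iInf_workload (m := m) n
  have hwσ : Integrable (fun ω => (⨅ i : Fin m, workload (σ · ω) (τ · ω) n i) * σ n ω) P :=
    hw.integrable_mul (h.memLp_service n)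
  have hwτ : Integrable (fun ω => (⨅ i : Fin m, workload (σ · ω) (τ · ω) n i) * τ (n + 1) ω) P :=
    hw.integrable_mul (h.memLp_interarrival (n + 1))
  have hσ2 := (h.memLp_service n).integrable_sq
  have hτ2 := (h.memLp_interarrival (n + 1)).integrable_sq
  have h1 : ∫ ω, ∑ i : Fin m, workload (σ · ω) (τ · ω) (n + 1) i ^ 2 ∂P ≤
      ∫ ω, (∑ i : Fin m, workload (σ · ω) (τ · ω) n i ^ 2 +
        2 * ((⨅ i : Fin m, workload (σ · ω) (τ · ω) n i) * σ n ω) -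
        2 * m * ((⨅ i : Fin m, workload (σ · ω) (τ · ω) n i) * τ (n + 1) ω) + σ n ω ^ 2 +
        m * τ (n + 1) ω ^ 2) ∂P := by
    refine integral_mono_ae (hΦ (n + 1)) ((((((hΦ n).add (hwσ.const_mul 2))).sub
      (hwτ.const_mul (2 * m))).add hσ2).add (hτ2.const_mul m)) ?_
    filter_upwards [h.ae_nonneg] with ω hω
    exact sum_sq_workload_succ_le hω.1 hω.2 n
  refine h1.trans (le_of_eq ?_)
  have key : ∀ {A B C D E : Ω → ℝ} (c d : ℝ), Integrable A P → Integrable B P →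
      Integrable C P → Integrable D P → Integrable E P →
      ∫ ω, (A ω + 2 * B ω - c * C ω + D ω + d * E ω) ∂P = ∫ ω, A ω ∂P + 2 * ∫ ω, B ω ∂P -
        c * ∫ ω, C ω ∂P + ∫ ω, D ω ∂P + d * ∫ ω, E ω ∂P := by
    intro A B C D E c d hA hB hC hD hE
    rw [integral_add, integral_add, integral_sub, integral_add, integral_const_mul,
      integral_const_mul, integral_const_mul] <;> fun_prop
  rw [key (2 * m) m (hΦ n) hwσ hwτ hσ2 hτ2]
  have h2 := (h.indepFun_iInf_workload_service m n).integral_fun_mul_eq_mul_integral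
    hw.aestronglyMeasurable (h.memLp_service n).aestronglyMeasurable
  have h3 := (h.indepFun_iInf_workload_interarrival m n).integral_fun_mul_eq_mul_integral
    hw.aestronglyMeasurable (h.memLp_interarrival (n + 1)).aestronglyMeasurable
  rw [h2, h3, h.integral_comp_service (f := fun t => t ^ 2) (by fun_prop) n,
    h.integral_comp_interarrival (f := fun t => t ^ 2) (by fun_prop) (n + 1)]
  rw [h.integral_service, h.integral_interarrival]
  ring

variable [IsProbabilityMeasure P]

theorem monotone_integral_delay (h : IsQueueInput σ τ P) :
    Monotone fun n => ∫ ω, delay m (σ · ω) (τ · ω) n ∂P := by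
  intro i j hij
  simp only [(h.identDistrib_reversedDelay m _).integral_eq]
  exact integral_mono ((h.identDistrib_reversedDelay m i).integrable_iff.1 (h.integrable_delay i))
    ((h.identDistrib_reversedDelay m j).integrable_iff.1 (h.integrable_delay j))
    fun ω => monotone_reversedDelay m _ _ hij

theorem integral_delay (h : IsQueueInput σ τ P) (n : ℕ) :
    ∫ ω, delay m (σ · ω) (τ · ω) n ∂P =
      ∫ ω, ⨅ i : Fin m, workload (σ · ω) (τ · ω) n i ∂P + ∫ ω, σ 0 ω ∂P := by
  rw [← h.integral_service n]
  exact integral_add ((h.memLp_iInf_workload n).integrable one_le_two)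
    ((h.memLp_service n).integrable one_le_two)

theorem exists_integral_delay_le (h : IsQueueInput σ τ P)
    (hlt : ∫ ω, σ 0 ω ∂P < m * ∫ ω, τ 0 ω ∂P) :
    ∃ C, ∀ n, ∫ ω, delay m (σ · ω) (τ · ω) n ∂P ≤ C := by
  set ε := m * ∫ ω, τ 0 ω ∂P - ∫ ω, σ 0 ω ∂P with hε
  have hε0 : 0 < ε := sub_pos.2 hlt
  set C := ∫ ω, σ 0 ω ^ 2 ∂P + m * ∫ ω, τ 0 ω ^ 2 ∂P with hC
  set w : ℕ → ℝ := fun n => ∫ ω, ⨅ i : Fin m, workload (σ · ω) (τ · ω) n i ∂P with hw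
  have hmono : Monotone w := by
    intro i j hij
    have := h.monotone_integral_delay (m := m) hij
    simp only [h.integral_delay] at this
    simpa using this
  have hsum : ∀ n, ∫ ω, ∑ i : Fin m, workload (σ · ω) (τ · ω) n i ^ 2 ∂P ≤
      n * C - 2 * ε * ∑ j ∈ Finset.range n, w j := by
    intro n
    induction n with
    | zero => simp [workload]
    | succ n ih =>
      have := h.integral_sum_sq_workload_succ_le (m := m) n
      rw [Finset.sum_range_succ]
      push_cast
      simp only [← hε, ← hC] at this
      linarith
  refine ⟨C / ε + ∫ ω, σ 0 ω ∂P, fun n => ?_⟩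
  rw [h.integral_delay]
  refine add_le_add ?_ le_rfl
  change w n ≤ C / ε
  have hw0 : ∀ n, 0 ≤ w n := fun n => integral_nonneg fun ω => iInf_workload_nonneg _ _ _
  have hC0 : 0 ≤ C := add_nonneg (integral_nonneg fun ω => sq_nonneg _)
    (mul_nonneg (Nat.cast_nonneg m) (integral_nonneg fun ω => sq_nonneg _))
  -- the last `n + 1` of the first `2 n + 2` terms are at least `w n`
  have h1 : (n + 1) * w n ≤ ∑ j ∈ Finset.range (2 * (n + 1)), w j := by
    rw [two_mul, Finset.sum_range_add]
    have h2 : (n + 1) * w n ≤ ∑ j ∈ Finset.range (n + 1), w (n + 1 + j) := by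
      have := Finset.card_nsmul_le_sum (Finset.range (n + 1)) (fun j => w (n + 1 + j)) (w n)
        fun j _ => hmono (by omega)
      simpa using this
    have h3 : 0 ≤ ∑ j ∈ Finset.range (n + 1), w j := Finset.sum_nonneg fun j _ => hw0 j
    linarith
  have h2 := hsum (2 * (n + 1))
  have h3 : 0 ≤ ∫ ω, ∑ i : Fin m, workload (σ · ω) (τ · ω) (2 * (n + 1)) i ^ 2 ∂P :=
    integral_nonneg fun ω => Finset.sum_nonneg fun i _ => sq_nonneg _
  push_cast at h2
  have h4 := mul_le_mul_of_nonneg_left h1 hε0.le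
  rw [le_div_iff₀ hε0]
  have h5 : (n + 1 : ℝ) * (w n * ε) ≤ (n + 1) * C := by linarith
  exact le_of_mul_le_mul_left h5 (by positivity)

/-- If the load is below the number of servers, the delays converge in distribution. -/
theorem exists_tendstoInDistribution_delay (h : IsQueueInput σ τ P)
    (hlt : ∫ ω, σ 0 ω ∂P < m * ∫ ω, τ 0 ω ∂P) :
    ∃ Z : Ω → ℝ, TendstoInDistribution (fun n ω => delay m (σ · ω) (τ · ω) n) atTop Z
      (fun _ => P) P := by
  obtain ⟨C, hC⟩ := h.exists_integral_delay_le hlt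
  obtain ⟨Z, hZ⟩ := exists_tendstoInDistribution_of_monotone
    (X := fun n ω => reversedDelay m (σ · ω) (τ · ω) n) (P := P) (C := C)
    (fun n => h.measurable_reversedDelay m n) (fun ω => monotone_reversedDelay m _ _)
    (fun n => by
      filter_upwards [h.ae_nonneg] with ω hω
      exact add_nonneg (iInf_workload_nonneg _ _ _) (hω.1 _))
    (fun n => (h.identDistrib_reversedDelay m n).integrable_iff.1 (h.integrable_delay n))
    fun n => by rw [← (h.identDistrib_reversedDelay m n).integral_eq]; exact hC n
  exact ⟨Z, hZ.congr_map (fun n => (h.measurable_delay m n).aemeasurable)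
    fun n => h.map_reversedDelay m n⟩

end IsQueueInput

/-! ### Instability at and above the critical load -/

/-- Convergence in distribution implies tightness of the upper tails. -/
theorem exists_eventually_measureReal_le {Ω Ω' : Type*} [MeasurableSpace Ω] [MeasurableSpace Ω']
    {P : Measure Ω} [IsProbabilityMeasure P] {Q : Measure Ω'} [IsProbabilityMeasure Q]
    {X : ℕ → Ω → ℝ} {Z : Ω' → ℝ} (h : TendstoInDistribution X atTop Z (fun _ => P) Q) {ε : ℝ}
    (hε : 0 < ε) : ∃ K, 0 ≤ K ∧ ∀ᶠ n in atTop, P.real {ω | K < X n ω} ≤ ε := by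
  have hZ := h.aemeasurable_limit
  have := Measure.isProbabilityMeasure_map hZ
  obtain ⟨K, hK, hK0⟩ := (((tendsto_cdf_atTop (Q.map Z)).eventually_const_lt
    (show 1 - ε < 1 by linarith)).and (eventually_ge_atTop 0)).exists
  refine ⟨K + 1, by linarith, ?_⟩
  have h1 := ProbabilityMeasure.limsup_measure_closed_le_of_tendsto h.tendsto
    (isClosed_Ici (a := K + 1))
  have h2 : (Q.map Z) (Ici (K + 1)) < ENNReal.ofReal ε := by
    refine (measure_mono (Ici_subset_Ioi.2 (lt_add_one K))).trans_lt ?_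
    rw [← compl_Iic, prob_compl_eq_one_sub measurableSet_Iic, ← ofReal_cdf, ← ENNReal.ofReal_one,
      ← ENNReal.ofReal_sub _ (cdf_nonneg _ _)]
    exact (ENNReal.ofReal_lt_ofReal_iff hε).2 (by linarith)
  filter_upwards [eventually_lt_of_limsup_lt (h1.trans_lt h2)] with n hn
  have h3 : P {ω | K + 1 < X n ω} ≤ (P.map (X n)) (Ici (K + 1)) := by
    rw [Measure.map_apply_of_aemeasurable (h.forall_aemeasurable n) measurableSet_Ici]
    exact measure_mono fun ω (hω : K + 1 < X n ω) => hω.le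
  exact ENNReal.toReal_le_of_le_ofReal hε.le (h3.trans hn.le)

/-- The total workload increases by the new service requirement and decreases by the work that `m`
busy servers would do, up to the time during which the chosen server is idle. -/
theorem sum_workload_add_le_sum_workload_succ {m : ℕ} [NeZero m] (σ τ : ℕ → ℝ) (n : ℕ) :
    ∑ i : Fin m, workload σ τ n i + (σ n - m * τ (n + 1)) + max 0 (τ (n + 1) - delay m σ τ n) ≤
      ∑ i : Fin m, workload σ τ (n + 1) i := by
  obtain ⟨i₀, hi₀⟩ := exists_isLeastLoaded (workload (m := m) σ τ n)
  rw [delay, hi₀.iInf_eq]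
  set u : Fin m → ℝ := workload σ τ n with hu
  have h1 : ∑ i, (addJob u (σ n) i - τ (n + 1)) = ∑ i, u i + (σ n - m * τ (n + 1)) := by
    have := sum_addJob hi₀ (σ n) id
    simp only [id] at this
    rw [Finset.sum_sub_distrib, this]
    simp
    ring
  have h2 := Finset.single_le_sum (f := fun i => workload σ τ (n + 1) i -
    (addJob u (σ n) i - τ (n + 1))) (fun i _ => sub_nonneg.2 (le_max_right _ _))
    (Finset.mem_univ i₀)
  have h3 : workload σ τ (n + 1) i₀ - (addJob u (σ n) i₀ - τ (n + 1)) =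
      max 0 (τ (n + 1) - (u i₀ + σ n)) := by
    simp only [workload, ← hu, addJob, hi₀, if_true]
    rcases max_cases 0 (u i₀ + σ n - τ (n + 1)) with h | h <;>
      rcases max_cases 0 (τ (n + 1) - (u i₀ + σ n)) with h' | h' <;> linarith
  rw [h3, Finset.sum_sub_distrib, h1] at h2
  linarith

/-- The total workload is controlled by the delay: the servers are balanced up to the largest
service requirement, and the least workload is compared with `K` or, if the delay exceeds `K`, with
its own square. -/
theorem sum_workload_le {m : ℕ} [NeZero m] {σ τ : ℕ → ℝ} (hσ : ∀ n, 0 ≤ σ n) (hτ : ∀ n, 0 ≤ τ n)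
    {η K : ℝ} (hη : 0 < η) (hK : 0 ≤ K) (n : ℕ) :
    ∑ i : Fin m, workload σ τ n i ≤ m * (K + 1 / η +
      2 * η * ∑ j ∈ Finset.range n, σ j ^ 2 + n / η * if K < delay m σ τ n then 1 else 0) := by
  obtain ⟨i₀, hi₀⟩ := exists_isLeastLoaded (workload (m := m) σ τ n)
  rw [delay, hi₀.iInf_eq]
  set u : Fin m → ℝ := workload σ τ n with hu
  set Q := ∑ j ∈ Finset.range n, σ j ^ 2 with hQ
  have hQ0 : 0 ≤ Q := Finset.sum_nonneg fun j _ => sq_nonneg _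
  have hη' : 0 < 1 / η := by positivity
  -- by AM-GM, so that the largest service requirement is replaced by a sum with known mean
  have hr : ∀ j < n, σ j ≤ 1 / η + η * Q := by
    intro j hj
    have h1 : σ j ^ 2 ≤ Q := Finset.single_le_sum (f := fun j => σ j ^ 2)
      (fun j _ => sq_nonneg _) (Finset.mem_range.2 hj)
    have h2 : 0 ≤ η * (σ j - 1 / η) ^ 2 := by positivity
    have h3 : η * (σ j - 1 / η) ^ 2 = η * σ j ^ 2 - 2 * σ j + 1 / η := by
      field_simp
      ring
    have h4 := mul_le_mul_of_nonneg_left h1 hη.le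
    have h5 := hσ j
    nlinarith
  have hbal : ∀ i, u i ≤ u i₀ + (1 / η + η * Q) := fun i =>
    workload_le_workload_add hσ (by positivity) hr i i₀
  have hmin : u i₀ ≤ K + η * Q + n / η * if K < u i₀ + σ n then 1 else 0 := by
    split_ifs with hD
    · rcases Nat.eq_zero_or_pos n with rfl | hn
      · have : u i₀ = 0 := rfl
        rw [this]; positivity
      have hn' : (0 : ℝ) < n := by exact_mod_cast hn
      have h1 : u i₀ ^ 2 ≤ n * Q := by
        have h2 := workload_le_sum hσ hτ n i₀
        have h3 : (∑ j ∈ Finset.range n, σ j) ^ 2 ≤ n * Q := by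
          simpa using sq_sum_le_card_mul_sum_sq (s := Finset.range n) (f := σ)
        exact (pow_le_pow_left₀ (workload_nonneg σ τ n i₀) h2 2).trans h3
      -- AM-GM again: `2 * u i₀ ≤ (η / n) * u i₀ ^ 2 + n / η`
      have h4 : 0 ≤ η / n * (u i₀ - n / η) ^ 2 := by positivity
      have h5 : η / n * (u i₀ - n / η) ^ 2 = η / n * u i₀ ^ 2 - 2 * u i₀ + n / η := by
        field_simp
        ring
      have h6 : η / n * u i₀ ^ 2 ≤ η * Q := by
        calc η / n * u i₀ ^ 2 ≤ η / n * (n * Q) := by gcongr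
          _ = η * Q := by field_simp
      have h7 := workload_nonneg σ τ n i₀
      have h8 : 0 ≤ n / η := by positivity
      rw [← hu] at h7
      linarith
    · have := hσ n
      have : 0 ≤ η * Q := by positivity
      push Not at hD
      linarith
  have hall : ∀ i ∈ Finset.univ, u i ≤ K + 1 / η + 2 * η * Q +
      n / η * if K < u i₀ + σ n then 1 else 0 := fun i _ => by
    have := hbal i
    linarith
  have := Finset.sum_le_card_nsmul Finset.univ u _ hall
  rwa [Finset.card_univ, Fintype.card_fin, nsmul_eq_mul] at this

namespace IsQueueInput

variable {Ω : Type*} [MeasurableSpace Ω] {P : Measure Ω} [IsProbabilityMeasure P]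
  {σ τ : ℕ → Ω → ℝ} {m : ℕ}

theorem integrable_sum_workload (h : IsQueueInput σ τ P) (n : ℕ) :
    Integrable (fun ω => ∑ i : Fin m, workload (σ · ω) (τ · ω) n i) P :=
  integrable_finsetSum _ fun i _ => (h.memLp_workload n i).integrable one_le_two

variable [NeZero m]

theorem mul_measureReal_le_integral_idle (h : IsQueueInput σ τ P) (n : ℕ) (K : ℝ) :
    P.real {ω | delay m (σ · ω) (τ · ω) n ≤ K} * P.real {ω | K + 1 ≤ τ 0 ω} ≤
      ∫ ω, max 0 (τ (n + 1) ω - delay m (σ · ω) (τ · ω) n) ∂P := by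
  have h1 : P.real {ω | K + 1 ≤ τ 0 ω} = P.real {ω | K + 1 ≤ τ (n + 1) ω} := by
    have h2 : P (τ 0 ⁻¹' Ici (K + 1)) = P (τ (n + 1) ⁻¹' Ici (K + 1)) := by
      rw [← Measure.map_apply (h.measurable_interarrival _) measurableSet_Ici,
        ← Measure.map_apply (h.measurable_interarrival _) measurableSet_Ici,
        h.law_interarrival (n + 1)]
    exact congrArg ENNReal.toReal h2
  have h3 := (h.indepFun_delay_interarrival m n).measure_inter_preimage_eq_mul _ _
    (measurableSet_Iic (a := K)) (measurableSet_Ici (a := K + 1))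
  have hmeas : MeasurableSet ({ω | delay m (σ · ω) (τ · ω) n ≤ K} ∩ {ω | K + 1 ≤ τ (n + 1) ω}) :=
    (h.measurable_delay m n measurableSet_Iic).inter
      (h.measurable_interarrival (n + 1) measurableSet_Ici)
  have h4 : P.real {ω | delay m (σ · ω) (τ · ω) n ≤ K} * P.real {ω | K + 1 ≤ τ (n + 1) ω} =
      P.real ({ω | delay m (σ · ω) (τ · ω) n ≤ K} ∩ {ω | K + 1 ≤ τ (n + 1) ω}) := by
    rw [measureReal_def, measureReal_def, measureReal_def, ← ENNReal.toReal_mul]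
    exact congrArg ENNReal.toReal h3.symm
  rw [h1, h4, ← integral_indicator_one hmeas]
  have hi : Integrable (fun ω => max 0 (τ (n + 1) ω - delay m (σ · ω) (τ · ω) n)) P :=
    (integrable_zero _ _ _).sup
      (((h.memLp_interarrival (n + 1)).integrable one_le_two).sub (h.integrable_delay n))
  refine integral_mono ((integrable_const 1).indicator hmeas) hi fun ω => ?_
  by_cases hω : ω ∈ {ω | delay m (σ · ω) (τ · ω) n ≤ K} ∩ {ω | K + 1 ≤ τ (n + 1) ω}
  · have h5 : delay m (σ · ω) (τ · ω) n ≤ K := hω.1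
    have h6 : K + 1 ≤ τ (n + 1) ω := hω.2
    rw [indicator_of_mem hω, Pi.one_apply]
    exact le_max_of_le_right (by linarith)
  · rw [indicator_of_notMem hω]
    exact le_max_left _ _

theorem integral_sum_workload_succ_ge (h : IsQueueInput σ τ P) (n : ℕ) (K : ℝ) :
    ∫ ω, ∑ i : Fin m, workload (σ · ω) (τ · ω) n i ∂P +
      (∫ ω, σ 0 ω ∂P - m * ∫ ω, τ 0 ω ∂P) +
      P.real {ω | delay m (σ · ω) (τ · ω) n ≤ K} * P.real {ω | K + 1 ≤ τ 0 ω} ≤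
      ∫ ω, ∑ i : Fin m, workload (σ · ω) (τ · ω) (n + 1) i ∂P := by
  have hσ := (h.memLp_service n).integrable one_le_two
  have hτ := (h.memLp_interarrival (n + 1)).integrable one_le_two
  have hi : Integrable (fun ω => max 0 (τ (n + 1) ω - delay m (σ · ω) (τ · ω) n)) P :=
    (integrable_zero _ _ _).sup (hτ.sub (h.integrable_delay n))
  have key : ∀ {A B C D : Ω → ℝ}, Integrable A P → Integrable B P →
      Integrable C P → Integrable D P →
      ∫ ω, (A ω + (B ω - m * C ω) + D ω) ∂P =
        ∫ ω, A ω ∂P + (∫ ω, B ω ∂P - m * ∫ ω, C ω ∂P) + ∫ ω, D ω ∂P := by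
    intro A B C D hA hB hC hD
    rw [integral_add, integral_add, integral_sub, integral_const_mul] <;> fun_prop
  have h1 := integral_mono (((h.integrable_sum_workload n).add (hσ.sub (hτ.const_mul m))).add hi)
    (h.integrable_sum_workload (m := m) (n + 1))
    (fun ω => sum_workload_add_le_sum_workload_succ (σ · ω) (τ · ω) n)
  have h2 := key (h.integrable_sum_workload (m := m) n) hσ hτ hi
  rw [h.integral_service, h.integral_interarrival] at h2
  have h3 := h.mul_measureReal_le_integral_idle (m := m) n K
  have h4 : ∫ ω, (∑ i : Fin m, workload (σ · ω) (τ · ω) n i + (σ n ω - m * τ (n + 1) ω) +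
      max 0 (τ (n + 1) ω - delay m (σ · ω) (τ · ω) n)) ∂P ≤
      ∫ ω, ∑ i : Fin m, workload (σ · ω) (τ · ω) (n + 1) i ∂P := h1
  rw [h2] at h4
  linarith

theorem integral_sum_workload_le (h : IsQueueInput σ τ P) {η K : ℝ} (hη : 0 < η) (hK : 0 ≤ K)
    (n : ℕ) :
    ∫ ω, ∑ i : Fin m, workload (σ · ω) (τ · ω) n i ∂P ≤ m * (K + 1 / η +
      2 * η * (n * ∫ ω, σ 0 ω ^ 2 ∂P) +
      n / η * P.real {ω | K < delay m (σ · ω) (τ · ω) n}) := by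
  have hmeas : MeasurableSet {ω | K < delay m (σ · ω) (τ · ω) n} :=
    h.measurable_delay m n measurableSet_Ioi
  have hind : Integrable ({ω | K < delay m (σ · ω) (τ · ω) n}.indicator (1 : Ω → ℝ)) P :=
    (integrable_const 1).indicator hmeas
  have hsq : Integrable (fun ω => ∑ j ∈ Finset.range n, σ j ω ^ 2) P :=
    integrable_finsetSum _ fun j _ => (h.memLp_service j).integrable_sq
  have h1 : ∫ ω, ∑ i : Fin m, workload (σ · ω) (τ · ω) n i ∂P ≤
      ∫ ω, (m * (K + 1 / η + 2 * η * ∑ j ∈ Finset.range n, σ j ω ^ 2 +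
        n / η * {ω | K < delay m (σ · ω) (τ · ω) n}.indicator (1 : Ω → ℝ) ω)) ∂P := by
    refine integral_mono_ae (h.integrable_sum_workload n) (by fun_prop) ?_
    filter_upwards [h.ae_nonneg] with ω hω
    refine (sum_workload_le hω.1 hω.2 hη hK n).trans (le_of_eq ?_)
    simp [indicator_apply]
  refine h1.trans (le_of_eq ?_)
  have h2 : ∫ ω, ∑ j ∈ Finset.range n, σ j ω ^ 2 ∂P = n * ∫ ω, σ 0 ω ^ 2 ∂P := by
    rw [integral_finsetSum _ fun j _ => (h.memLp_service j).integrable_sq]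
    simp only [h.integral_comp_service (f := fun t => t ^ 2) (by fun_prop) _]
    simp
  rw [integral_const_mul, integral_add (by fun_prop) (by fun_prop),
    integral_add (by fun_prop) (by fun_prop), integral_const_mul, integral_const_mul, h2,
    integral_indicator_one hmeas]
  simp

/-- If the delays converge in distribution and the inter-arrival times are unbounded, then the load
is below the number of servers. -/
theorem integral_service_lt_of_tendstoInDistribution (h : IsQueueInput σ τ P)
    (hτ : ∀ K, 0 < P.real {ω | K ≤ τ 0 ω}) {Ω' : Type*} [MeasurableSpace Ω'] {Q : Measure Ω'}
    [IsProbabilityMeasure Q] {Z : Ω' → ℝ}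
    (hZ : TendstoInDistribution (fun n ω => delay m (σ · ω) (τ · ω) n) atTop Z (fun _ => P) Q) :
    ∫ ω, σ 0 ω ∂P < m * ∫ ω, τ 0 ω ∂P := by
  by_contra! hge
  have hm : (0 : ℝ) < m := by exact_mod_cast NeZero.pos m
  obtain ⟨K, -, hK⟩ := exists_eventually_measureReal_le hZ (show (0 : ℝ) < 1 / 2 by norm_num)
  set δ := 1 / 2 * P.real {ω | K + 1 ≤ τ 0 ω} with hδ
  have hδ0 : 0 < δ := mul_pos (by norm_num) (hτ _)
  set S := ∫ ω, σ 0 ω ^ 2 ∂P with hS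
  have hS0 : 0 ≤ S := integral_nonneg fun ω => sq_nonneg _
  -- a truncation parameter for which the second moments cost at most `n * δ / 4`
  set η := δ / (8 * m * (S + 1)) with hη
  have hη0 : 0 < η := by positivity
  obtain ⟨K', hK'0, hK'⟩ := exists_eventually_measureReal_le hZ
    (show (0 : ℝ) < η * δ / (4 * m) by positivity)
  -- from job `N` on, the mean total workload increases by at least `δ` per job
  obtain ⟨N, hN⟩ := eventually_atTop.1 (hK.and hK')
  set T : ℕ → ℝ := fun n => ∫ ω, ∑ i : Fin m, workload (σ · ω) (τ · ω) n i ∂P with hT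
  have hlow : ∀ j, j * δ ≤ T (N + j) := by
    intro j
    induction j with
    | zero =>
      simpa using integral_nonneg fun ω => Finset.sum_nonneg fun i _ => workload_nonneg _ _ _ _
    | succ j ih =>
      have h1 := h.integral_sum_workload_succ_ge (m := m) (N + j) K
      have h2 : 1 / 2 ≤ P.real {ω | delay m (σ · ω) (τ · ω) (N + j) ≤ K} := by
        have h3 := (hN (N + j) (by omega)).1
        have h4 : {ω | delay m (σ · ω) (τ · ω) (N + j) ≤ K} =
            {ω | K < delay m (σ · ω) (τ · ω) (N + j)}ᶜ := by ext; simp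
        have h6 : MeasurableSet {ω | K < delay m (σ · ω) (τ · ω) (N + j)} :=
          h.measurable_delay m _ measurableSet_Ioi
        rw [h4, probReal_compl_eq_one_sub h6]
        linarith
      have h5 := mul_le_mul_of_nonneg_right h2 (hτ (K + 1)).le
      push_cast
      change T (N + j) + _ + _ ≤ T (N + j + 1) at h1
      change _ ≤ T (N + j + 1)
      linarith
  have hup : ∀ j : ℕ, T (N + j) ≤ m * (K' + 1 / η) + (N + j) * (δ / 2) := by
    intro j
    have h1 := h.integral_sum_workload_le (m := m) hη0 hK'0 (N + j)
    have h2 := (hN (N + j) (by omega)).2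
    push_cast at h1
    have h3 : (N + j : ℝ) / η * P.real {ω | K' < delay m (σ · ω) (τ · ω) (N + j)} ≤
        (N + j : ℝ) / η * (η * δ / (4 * m)) := mul_le_mul_of_nonneg_left h2 (by positivity)
    have h4 : (N + j : ℝ) / η * (η * δ / (4 * m)) = (N + j) * δ / (4 * m) := by field_simp
    have h5 : 2 * η * ((N + j) * S) ≤ (N + j) * δ / (4 * m) := by
      have : 2 * η * (S + 1) = δ / (4 * m) := by rw [hη]; field_simp; ring
      calc 2 * η * ((N + j) * S) = (N + j) * (2 * η * S) := by ring
        _ ≤ (N + j) * (2 * η * (S + 1)) := by gcongr; linarith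
        _ = (N + j) * δ / (4 * m) := by rw [this]; ring
    calc T (N + j) ≤ _ := h1
      _ ≤ m * (K' + 1 / η + (N + j) * δ / (4 * m) + (N + j) * δ / (4 * m)) := by
          gcongr
          exact h3.trans h4.le
      _ = _ := by field_simp; ring
  obtain ⟨j, hj⟩ := exists_nat_gt ((m * (K' + 1 / η) + N * (δ / 2)) / (δ / 2))
  rw [div_lt_iff₀ (by positivity)] at hj
  have h1 := (hlow j).trans (hup j)
  linarith

end IsQueueInput

/-! ### Order statistics of independent exponential variables -/

section Exponential

open Real Topology

theorem measureReal_expMeasure_Iic {r : ℝ} (hr : 0 < r) {t : ℝ} (ht : 0 ≤ t) :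
    (expMeasure r).real (Iic t) = 1 - exp (-(r * t)) := by
  have := isProbabilityMeasure_expMeasure hr
  rw [← cdf_eq_real, cdf_expMeasure_eq hr, if_pos ht]

theorem measureReal_expMeasure_Ioi {r : ℝ} (hr : 0 < r) {t : ℝ} (ht : 0 ≤ t) :
    (expMeasure r).real (Ioi t) = exp (-(r * t)) := by
  have := isProbabilityMeasure_expMeasure hr
  rw [← compl_Iic, probReal_compl_eq_one_sub measurableSet_Iic, measureReal_expMeasure_Iic hr ht]
  ring

theorem ae_nonneg_expMeasure {r : ℝ} (hr : 0 < r) : ∀ᵐ x ∂expMeasure r, 0 ≤ x := by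
  have := isProbabilityMeasure_expMeasure hr
  have h : (expMeasure r).real (Iic 0) = 0 := by
    rw [measureReal_expMeasure_Iic hr le_rfl]; simp
  have h0 : expMeasure r (Iic 0) = 0 := (measureReal_eq_zero_iff).1 h
  refine measure_mono_null (fun x hx => ?_) h0
  exact (not_le.1 (show ¬ 0 ≤ x from hx)).le

theorem memLp_two_id_expMeasure {r : ℝ} (hr : 0 < r) : MemLp id 2 (expMeasure r) := by
  rw [memLp_two_iff_integrable_sq measurable_id.aestronglyMeasurable]
  have h1 : IntegrableOn (fun x : ℝ => x ^ (2 : ℝ) * exp (-r * x ^ (1 : ℝ))) (Ioi 0) :=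
    integrableOn_rpow_mul_exp_neg_mul_rpow (by norm_num) one_pos hr
  have h2 : Measurable (gammaPDF 1 r) := (measurable_gammaPDFReal 1 r).ennreal_ofReal
  rw [expMeasure, gammaMeasure, integrable_withDensity_iff h2
    (ae_of_all _ fun x => ENNReal.ofReal_lt_top)]
  rw [← integrable_indicator_iff measurableSet_Ioi] at h1
  refine (h1.const_mul r).congr (ae_of_all _ fun x => ?_)
  have h3 : gammaPDF 1 r x = exponentialPDF r x := rfl
  simp only [h3, exponentialPDF_eq, id]
  by_cases hx : 0 < x
  · rw [indicator_of_mem (mem_Ioi.2 hx), if_pos hx.le, ENNReal.toReal_ofReal (by positivity)]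
    simp only [rpow_one, rpow_two, neg_mul]
    ring
  · rw [indicator_of_notMem (by simpa using hx)]
    rcases (not_lt.1 hx).eq_or_lt with rfl | hx'
    · simp
    · simp [not_le.2 hx']

/-- The probability that exactly `q` of `k` independent exponential variables of rate `r` are at
most `t`. -/
noncomputable def expCount (r : ℝ) (k q : ℕ) (t : ℝ) : ℝ :=
  k.choose q * (1 - exp (-(r * t))) ^ q * exp (-(r * t)) ^ (k - q)

theorem expCount_nonneg {r : ℝ} (hr : 0 < r) (k q : ℕ) {t : ℝ} (ht : 0 ≤ t) :
    0 ≤ expCount r k q t := by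
  have h : exp (-(r * t)) ≤ 1 := exp_le_one_iff.2 (by nlinarith)
  have := sub_nonneg.2 h
  unfold expCount
  positivity

theorem hasDerivAt_exp_pow (r : ℝ) (n : ℕ) (t : ℝ) :
    HasDerivAt (fun t => exp (-(r * t)) ^ n) (-(r * n) * exp (-(r * t)) ^ n) t := by
  have h : HasDerivAt (fun t => exp (-(r * t))) (exp (-(r * t)) * -(r * 1)) t :=
    (((hasDerivAt_id t).const_mul r).neg).exp
  refine (h.pow n).congr_deriv ?_
  cases n with
  | zero => simp
  | succ n => rw [Nat.add_sub_cancel, pow_succ]; ring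

/-- The balance equation of the pure death process: the number of unfinished tasks drops from
`k - q` at rate `r (k - q)`, so that `P(N ≤ q)' = - r (k - q) P(N = q)` for the number `N` of
finished tasks. -/
theorem hasDerivAt_sum_expCount (r : ℝ) {k q : ℕ} (hq : q ≤ k) (t : ℝ) :
    HasDerivAt (fun t => ∑ j ∈ Finset.range (q + 1), expCount r k j t)
      (-(r * (k - q)) * expCount r k q t) t := by
  induction q with
  | zero =>
    simp only [zero_add, Finset.sum_range_one, expCount, Nat.choose_zero_right, Nat.cast_one,
      pow_zero, mul_one, one_mul, tsub_zero, Nat.cast_zero]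
    exact hasDerivAt_exp_pow r k t
  | succ q ih =>
    have ih := ih (by omega)
    simp only [Finset.sum_range_succ _ (q + 1)]
    have h1 : HasDerivAt (fun t => (1 - exp (-(r * t))) ^ (q + 1))
        ((q + 1 : ℕ) * (1 - exp (-(r * t))) ^ q * (r * exp (-(r * t)))) t := by
      have h := (hasDerivAt_exp_pow r 1 t).const_sub 1
      simp only [pow_one] at h
      refine (h.pow (q + 1)).congr_deriv ?_
      rw [Nat.add_sub_cancel]
      push_cast
      ring
    have h2 : HasDerivAt (expCount r k (q + 1)) _ t :=
      (h1.const_mul (k.choose (q + 1) : ℝ)).mul (hasDerivAt_exp_pow r (k - (q + 1)) t)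
    refine (ih.add h2).congr_deriv ?_
    have h3 : (k.choose (q + 1) : ℝ) * (q + 1) = k.choose q * (k - q) := by
      have := Nat.choose_succ_right_eq k q
      have h4 : ((k - q : ℕ) : ℝ) = k - q := Nat.cast_sub (by omega)
      rw [← h4]
      exact_mod_cast this
    have h5 : ((k - (q + 1) : ℕ) : ℝ) = k - (q + 1 : ℕ) := Nat.cast_sub hq
    have h6 : k - q = (k - (q + 1)) + 1 := by omega
    simp only [expCount, h5, h6, pow_succ]
    push_cast
    linear_combination (r * (1 - exp (-(r * t))) ^ q * exp (-(r * t)) ^ (k - (q + 1)) *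
      exp (-(r * t))) * h3

theorem tendsto_sum_expCount {r : ℝ} (hr : 0 < r) {k q : ℕ} (hq : q < k) :
    Tendsto (fun t => ∑ j ∈ Finset.range (q + 1), expCount r k j t) atTop (𝓝 0) := by
  have hE : Tendsto (fun t => exp (-(r * t))) atTop (𝓝 0) :=
    tendsto_exp_neg_atTop_nhds_zero.comp (tendsto_id.const_mul_atTop hr)
  rw [show (0 : ℝ) = ∑ j ∈ Finset.range (q + 1), 0 by simp]
  refine tendsto_finsetSum _ fun j hj => ?_
  have hj' : k - j ≠ 0 := by have := Finset.mem_range.1 hj; omega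
  have h : Tendsto (fun t => expCount r k j t) atTop
      (𝓝 (k.choose j * (1 - 0) ^ j * 0 ^ (k - j))) :=
    (((hE.const_sub 1).pow j).const_mul (k.choose j : ℝ)).mul (hE.pow (k - j))
  simpa [zero_pow hj'] using h

theorem sum_expCount_zero (r : ℝ) (k q : ℕ) :
    ∑ j ∈ Finset.range (q + 1), expCount r k j 0 = 1 := by
  rw [Finset.sum_range_succ', Finset.sum_eq_zero fun j _ => by simp [expCount]]
  simp [expCount]

theorem integrableOn_expCount {r : ℝ} (hr : 0 < r) {k q : ℕ} (hq : q < k) :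
    IntegrableOn (expCount r k q) (Ioi 0) := by
  have hkq : (0 : ℝ) < k - q := sub_pos.2 (by exact_mod_cast hq)
  have h := integrableOn_Ioi_deriv_of_nonpos' (a := 0)
    (fun t _ => hasDerivAt_sum_expCount r hq.le t)
    (fun t ht => mul_nonpos_of_nonpos_of_nonneg (by nlinarith)
      (expCount_nonneg hr k q (le_of_lt ht)))
    (tendsto_sum_expCount hr hq)
  have h2 := h.const_mul (-(r * (k - q)))⁻¹
  refine h2.congr (ae_of_all _ fun t => ?_)
  beta_reduce
  rw [← mul_assoc, inv_mul_cancel₀ (neg_ne_zero.2 (mul_pos hr hkq).ne'), one_mul]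

theorem integral_expCount {r : ℝ} (hr : 0 < r) {k q : ℕ} (hq : q < k) :
    ∫ t in Ioi 0, expCount r k q t = 1 / (r * (k - q)) := by
  have hkq : (0 : ℝ) < k - q := sub_pos.2 (by exact_mod_cast hq)
  have h := integral_Ioi_of_hasDerivAt_of_nonpos' (a := 0)
    (fun t _ => hasDerivAt_sum_expCount r hq.le t)
    (fun t ht => mul_nonpos_of_nonpos_of_nonneg (by nlinarith)
      (expCount_nonneg hr k q (le_of_lt ht)))
    (tendsto_sum_expCount hr hq)
  rw [integral_const_mul, sum_expCount_zero] at h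
  have := mul_pos hr hkq
  rw [eq_div_iff this.ne']
  linarith

variable {Ω : Type*} [MeasurableSpace Ω] {P : Measure Ω} {r : ℝ}

theorem memLp_two_of_map_eq_expMeasure (hr : 0 < r) {Y : Ω → ℝ} (hY : Measurable Y)
    (hlaw : P.map Y = expMeasure r) : MemLp Y 2 P := by
  have h := memLp_two_id_expMeasure hr
  rw [← hlaw, memLp_map_measure_iff measurable_id.aestronglyMeasurable hY.aemeasurable] at h
  exact h

theorem ae_nonneg_of_map_eq_expMeasure (hr : 0 < r) {Y : Ω → ℝ} (hY : Measurable Y)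
    (hlaw : P.map Y = expMeasure r) : ∀ᵐ ω ∂P, 0 ≤ Y ω := by
  have h := ae_nonneg_expMeasure hr
  rw [← hlaw] at h
  exact ae_of_ae_map hY.aemeasurable h

theorem measureReal_lt_of_map_eq_expMeasure (hr : 0 < r) {Y : Ω → ℝ} (hY : Measurable Y)
    (hlaw : P.map Y = expMeasure r) {t : ℝ} (ht : 0 ≤ t) :
    P.real {ω | t < Y ω} = exp (-(r * t)) := by
  rw [← measureReal_expMeasure_Ioi hr ht, ← hlaw, map_measureReal_apply hY measurableSet_Ioi]
  rfl

variable {k : ℕ} {X : Fin k → Ω → ℝ}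

theorem ae_orderStat_nonneg (hr : 0 < r) (hX : ∀ j, Measurable (X j))
    (hlaw : ∀ j, P.map (X j) = expMeasure r) {i : ℕ} (hi : 1 ≤ i) (hik : i ≤ k) :
    ∀ᵐ ω ∂P, 0 ≤ orderStat (fun j => X j ω) i := by
  filter_upwards [ae_all_iff.2 fun j => ae_nonneg_of_map_eq_expMeasure hr (hX j) (hlaw j)] with ω hω
  obtain ⟨j, hj⟩ := exists_orderStat_eq (fun j => X j ω) hi hik
  rw [hj]
  exact hω j

theorem memLp_two_orderStat (hr : 0 < r) (hX : ∀ j, Measurable (X j))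
    (hlaw : ∀ j, P.map (X j) = expMeasure r) {i : ℕ} (hi : 1 ≤ i) (hik : i ≤ k) :
    MemLp (fun ω => orderStat (fun j => X j ω) i) 2 P := by
  have h : MemLp (fun ω => ∑ j, |X j ω|) 2 P :=
    memLp_finsetSum _ fun j _ => (memLp_two_of_map_eq_expMeasure hr (hX j) (hlaw j)).abs
  refine h.of_le ((measurable_orderStat hi hik).comp
    (measurable_pi_lambda _ hX)).aestronglyMeasurable (ae_of_all _ fun ω => ?_)
  obtain ⟨j, hj⟩ := exists_orderStat_eq (fun j => X j ω) hi hik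
  rw [hj, norm_eq_abs, norm_eq_abs]
  exact (Finset.single_le_sum (f := fun j => |X j ω|) (fun j _ => abs_nonneg _)
    (Finset.mem_univ j)).trans (le_abs_self _)

variable [IsProbabilityMeasure P]

theorem integral_of_map_eq_expMeasure (hr : 0 < r) {Y : Ω → ℝ} (hY : Measurable Y)
    (hlaw : P.map Y = expMeasure r) : ∫ ω, Y ω ∂P = 1 / r := by
  rw [((memLp_two_of_map_eq_expMeasure hr hY hlaw).integrable
    one_le_two).integral_eq_integral_meas_lt (ae_nonneg_of_map_eq_expMeasure hr hY hlaw)]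
  have h := integral_expCount hr (k := 1) (q := 0) one_pos
  simp only [Nat.cast_one, Nat.cast_zero, sub_zero, mul_one] at h
  rw [← h]
  refine setIntegral_congr_fun measurableSet_Ioi fun t ht => ?_
  simp only [measureReal_lt_of_map_eq_expMeasure hr hY hlaw (le_of_lt ht)]
  simp [expCount]

theorem measureReal_lt_orderStat (hr : 0 < r) (hX : ∀ j, Measurable (X j))
    (hlaw : ∀ j, P.map (X j) = expMeasure r) (hind : iIndepFun X P) {i : ℕ} (hi : 1 ≤ i)
    (hik : i ≤ k) {t : ℝ} (ht : 0 ≤ t) :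
    P.real {ω | t < orderStat (fun j => X j ω) i} =
      ∑ q ∈ Finset.range i, expCount r k q t := by
  classical
  -- the event that `S` is the set of the indices `j` with `X j ≤ t`
  let B : Finset (Fin k) → Set Ω := fun S => ⋂ j ∈ Finset.univ,
    X j ⁻¹' (if j ∈ S then Iic t else Ioi t)
  have hBmem : ∀ S ω, ω ∈ B S ↔ Finset.univ.filter (fun j => X j ω ≤ t) = S := by
    intro S ω
    simp only [B, mem_iInter, Finset.mem_univ, forall_true_left, mem_preimage, Finset.ext_iff,
      Finset.mem_filter, true_and]
    refine forall_congr' fun j => ?_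
    split_ifs with h <;> simp [h]
  have hmeas : ∀ S : Finset (Fin k), ∀ j : Fin k, MeasurableSet (if j ∈ S then Iic t else Ioi t) := by
    intro S j
    split_ifs
    exacts [measurableSet_Iic, measurableSet_Ioi]
  have hBm : ∀ S, MeasurableSet (B S) := fun S =>
    Finset.measurableSet_biInter _ fun j _ => hX j (hmeas S j)
  have hBP : ∀ S : Finset (Fin k),
      P.real (B S) = (1 - exp (-(r * t))) ^ S.card * exp (-(r * t)) ^ (k - S.card) := by
    intro S
    have h1 := hind.measure_inter_preimage_eq_mul Finset.univ (fun j _ => hmeas S j)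
    have h2 : P.real (B S) = ∏ j : Fin k, P.real (X j ⁻¹' (if j ∈ S then Iic t else Ioi t)) := by
      rw [measureReal_def, h1, ENNReal.toReal_prod]
      rfl
    have h3 : ∀ j, P.real (X j ⁻¹' (if j ∈ S then Iic t else Ioi t)) =
        if j ∈ S then 1 - exp (-(r * t)) else exp (-(r * t)) := by
      intro j
      rw [← map_measureReal_apply (hX j) (hmeas S j), hlaw j]
      split_ifs
      exacts [measureReal_expMeasure_Iic hr ht, measureReal_expMeasure_Ioi hr ht]
    rw [h2, Finset.prod_congr rfl fun j _ => h3 j, Finset.prod_ite, Finset.prod_const,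
      Finset.prod_const]
    congr 2
    · simp
    · rw [Finset.filter_not, Finset.card_sdiff]
      simp
  have hset : {ω | t < orderStat (fun j => X j ω) i} =
      ⋃ S ∈ (Finset.univ : Finset (Fin k)).powerset.filter (fun S => S.card < i), B S := by
    ext ω
    have h1 := (orderStat_le_iff (fun j => X j ω) hi hik t).not
    rw [not_le, not_le] at h1
    simp only [mem_ofPred_eq, h1, mem_iUnion, hBmem]
    simp
  rw [hset, measureReal_biUnion_finset ?_ fun S _ => hBm S]
  · rw [Finset.sum_congr rfl fun S _ => hBP S, Finset.sum_filter,
      Finset.sum_powerset_apply_card fun q => if q < i then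
        (1 - exp (-(r * t))) ^ q * exp (-(r * t)) ^ (k - q) else 0]
    rw [Finset.card_univ, Fintype.card_fin,
      ← Finset.sum_subset (Finset.range_mono (by omega : i ≤ k + 1))]
    · refine Finset.sum_congr rfl fun q hq => ?_
      rw [if_pos (Finset.mem_range.1 hq), expCount, nsmul_eq_mul, mul_assoc]
    · intro q _ hq
      rw [if_neg (by simpa using hq), smul_zero]
  · intro S _ T _ hST
    refine Set.disjoint_left.2 fun ω hS hT => hST ?_
    exact ((hBmem S ω).1 hS).symm.trans ((hBmem T ω).1 hT)

theorem sum_one_div_eq_harmonic_sub {k i : ℕ} (hik : i ≤ k) :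
    ∑ q ∈ Finset.range i, 1 / ((k : ℝ) - q) = (harmonic k : ℝ) - (harmonic (k - i) : ℝ) := by
  induction i with
  | zero => simp
  | succ i ih =>
    rw [Finset.sum_range_succ, ih (by omega), show k - i = (k - (i + 1)) + 1 by omega,
      harmonic_succ]
    have : ((k - (i + 1) : ℕ) : ℝ) = k - (i + 1 : ℕ) := Nat.cast_sub hik
    push_cast [this]
    rw [one_div, show (k : ℝ) - (i + 1) + 1 = k - i by ring]
    ring

/-- The mean of the `i`-th order statistic of `k` independent exponential variables. -/
theorem integral_orderStat (hr : 0 < r) (hX : ∀ j, Measurable (X j))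
    (hlaw : ∀ j, P.map (X j) = expMeasure r) (hind : iIndepFun X P) {i : ℕ} (hi : 1 ≤ i)
    (hik : i ≤ k) :
    ∫ ω, orderStat (fun j => X j ω) i ∂P =
      ((harmonic k : ℝ) - (harmonic (k - i) : ℝ)) / r := by
  rw [((memLp_two_orderStat hr hX hlaw hi hik).integrable
    one_le_two).integral_eq_integral_meas_lt (ae_orderStat_nonneg hr hX hlaw hi hik),
    setIntegral_congr_fun measurableSet_Ioi fun t ht =>
      measureReal_lt_orderStat hr hX hlaw hind hi hik (le_of_lt ht),
    integral_finsetSum _ fun q hq =>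
      integrableOn_expCount hr ((Finset.mem_range.1 hq).trans_le hik),
    Finset.sum_congr rfl fun q hq =>
      integral_expCount hr ((Finset.mem_range.1 hq).trans_le hik),
    ← sum_one_div_eq_harmonic_sub hik, Finset.sum_div]
  refine Finset.sum_congr rfl fun q _ => ?_
  rw [div_div, mul_comm]

end Exponential

/-! ### The barrier system -/

theorem sum_harmonic_sub {k l : ℕ} (hlk : l ≤ k) :
    ∑ i ∈ Finset.Icc 1 l, ((harmonic k : ℝ) - (harmonic (k - i) : ℝ)) =
      l - ((k : ℝ) - l) * ((harmonic k : ℝ) - (harmonic (k - l) : ℝ)) := by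
  induction l with
  | zero => simp
  | succ l ih =>
    rw [Finset.sum_Icc_succ_top (by omega), ih (by omega),
      show k - l = (k - (l + 1)) + 1 by omega, harmonic_succ]
    have h : ((k - (l + 1) : ℕ) : ℝ) = k - (l + 1) := by rw [Nat.cast_sub hlk]; push_cast; ring
    have h1 : (k : ℝ) - l ≠ 0 := sub_ne_zero.2 (by exact_mod_cast (by omega : k ≠ l))
    push_cast [h]
    rw [show (k : ℝ) - (l + 1) + 1 = k - l by ring]
    field_simp
    ring

theorem harmonic_sub_pos {k l : ℕ} (hl : 1 ≤ l) (hlk : l ≤ k) :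
    0 < (harmonic k : ℝ) - (harmonic (k - l) : ℝ) := by
  rw [← sum_one_div_eq_harmonic_sub hlk]
  refine Finset.sum_pos (fun q hq => ?_) ⟨0, Finset.mem_range.2 hl⟩
  have : (q : ℝ) < k := by exact_mod_cast (Finset.mem_range.1 hq).trans_le hlk
  have := sub_pos.2 this
  positivity

/-- The mean useful server time is positive. -/
theorem sub_mul_harmonic_sub_pos {k l : ℕ} (hl : 1 ≤ l) (hlk : l ≤ k) :
    0 < l - ((k : ℝ) - l) * ((harmonic k : ℝ) - (harmonic (k - l) : ℝ)) := by
  rw [← sum_harmonic_sub hlk]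
  refine Finset.sum_pos (fun i hi => ?_) ⟨1, Finset.mem_Icc.2 ⟨le_rfl, hl⟩⟩
  rw [Finset.mem_Icc] at hi
  exact harmonic_sub_pos hi.1 (hi.2.trans hlk)

namespace SklSystem

variable {s k l : ℕ} {lam μ : ℝ} (S : SklSystem.{u} s k l lam μ)

theorem iIndepFun_task (n : ℕ) : iIndepFun (S.task n) S.P :=
  S.indep.precomp (g := fun i : Fin k => Sum.inr (n, i)) fun i j h => by simpa using h

theorem measurable_taskOrderStat (n : ℕ) {i : ℕ} (hi : 1 ≤ i) (hik : i ≤ k) :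
    Measurable (S.taskOrderStat n i) :=
  (measurable_orderStat hi hik).comp (measurable_pi_lambda _ (S.measurable_task n))

theorem integrable_taskOrderStat (hμ : 0 < μ) (n : ℕ) {i : ℕ} (hi : 1 ≤ i) (hik : i ≤ k) :
    Integrable (S.taskOrderStat n i) S.P :=
  (memLp_two_orderStat hμ (S.measurable_task n) (S.law_task n) hi hik).integrable one_le_two

theorem integral_taskOrderStat (hμ : 0 < μ) (n : ℕ) {i : ℕ} (hi : 1 ≤ i) (hik : i ≤ k) :
    ∫ ω, S.taskOrderStat n i ω ∂S.P = ((harmonic k : ℝ) - (harmonic (k - i) : ℝ)) / μ :=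
  integral_orderStat hμ (S.measurable_task n) (S.law_task n) (S.iIndepFun_task n) hi hik

theorem integrable_usefulServerTime (hμ : 0 < μ) (hlk : l ≤ k) (n : ℕ) :
    Integrable (S.usefulServerTime n) S.P :=
  integrable_finsetSum _ fun _ hi => S.integrable_taskOrderStat hμ n (Finset.mem_Icc.1 hi).1
    ((Finset.mem_Icc.1 hi).2.trans hlk)

theorem integral_usefulServerTime (hμ : 0 < μ) (hlk : l ≤ k) (n : ℕ) :
    ∫ ω, S.usefulServerTime n ω ∂S.P =
      (l - ((k : ℝ) - l) * ((harmonic k : ℝ) - (harmonic (k - l) : ℝ))) / μ := by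
  have h : ∀ i ∈ Finset.Icc 1 l, 1 ≤ i ∧ i ≤ k := fun i hi =>
    ⟨(Finset.mem_Icc.1 hi).1, (Finset.mem_Icc.1 hi).2.trans hlk⟩
  simp only [usefulServerTime]
  rw [integral_finsetSum _ fun i hi => S.integrable_taskOrderStat hμ n (h i hi).1 (h i hi).2,
    Finset.sum_congr rfl fun i hi => S.integral_taskOrderStat hμ n (h i hi).1 (h i hi).2,
    ← Finset.sum_div, sum_harmonic_sub hlk]

theorem integrable_totalServerTime (hμ : 0 < μ) (hl : 1 ≤ l) (hlk : l ≤ k) (n : ℕ) :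
    Integrable (S.totalServerTime n) S.P :=
  (S.integrable_usefulServerTime hμ hlk n).add
    ((S.integrable_taskOrderStat hμ n hl hlk).const_mul _)

theorem integral_totalServerTime (hμ : 0 < μ) (hl : 1 ≤ l) (hlk : l ≤ k) (n : ℕ) :
    ∫ ω, S.totalServerTime n ω ∂S.P = l / μ := by
  have h : ∫ ω, S.totalServerTime n ω ∂S.P = ∫ ω, S.usefulServerTime n ω ∂S.P +
      ∫ ω, ((k : ℝ) - l) * S.taskOrderStat n l ω ∂S.P :=
    integral_add (S.integrable_usefulServerTime hμ hlk n)
      ((S.integrable_taskOrderStat hμ n hl hlk).const_mul _)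
  rw [h, S.integral_usefulServerTime hμ hlk, integral_const_mul,
    S.integral_taskOrderStat hμ n hl hlk]
  ring

/-- The holding times `X_(l:k)` and the inter-arrival times are the input of a queue. -/
theorem isQueueInput (hlam : 0 < lam) (hμ : 0 < μ) (hl : 1 ≤ l) (hlk : l ≤ k) :
    IsQueueInput (fun n => S.taskOrderStat n l) S.interarrival S.P := by
  set Z : ℕ ⊕ (ℕ × Fin k) → S.Ω → ℝ := fun j =>
    Sum.elim S.interarrival (fun p => S.task p.1 p.2) j with hZ
  have hm : ∀ j, Measurable (Z j) := by
    rintro (n | p)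
    exacts [S.measurable_interarrival n, S.measurable_task p.1 p.2]
  have hrep : ∀ n, S.P.map (fun ω i => S.task n i ω) = S.P.map (fun ω i => S.task 0 i ω) := by
    intro n
    rw [(S.iIndepFun_task n).map_fun_eq_infinitePi_map (S.measurable_task n),
      (S.iIndepFun_task 0).map_fun_eq_infinitePi_map (S.measurable_task 0)]
    simp only [S.law_task]
  refine
    { measurable_service := fun n => S.measurable_taskOrderStat n hl hlk
      measurable_interarrival := S.measurable_interarrival
      indep := ?_
      law_service := fun n => ?_
      law_interarrival := fun n => by rw [S.law_interarrival, S.law_interarrival]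
      service_nonneg := fun n => ae_orderStat_nonneg hμ (S.measurable_task n) (S.law_task n) hl hlk
      interarrival_nonneg := fun n =>
        ae_nonneg_of_map_eq_expMeasure hlam (S.measurable_interarrival n) (S.law_interarrival n)
      memLp_service := fun n => memLp_two_orderStat hμ (S.measurable_task n) (S.law_task n) hl hlk
      memLp_interarrival := fun n =>
        memLp_two_of_map_eq_expMeasure hlam (S.measurable_interarrival n) (S.law_interarrival n) }
  · let B : ℕ ⊕ ℕ → Set (ℕ ⊕ (ℕ × Fin k)) :=
      Sum.elim (fun n => {Sum.inl n}) fun n => range fun i => Sum.inr (n, i)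
    have hB : Pairwise fun a b => Disjoint (B a) (B b) := by
      intro a b hab
      rw [Set.disjoint_left]
      rcases a with a | a <;> rcases b with b | b <;> simp_all [B]
      exact fun _ h => hab h.symm
    refine iIndepFun_of_disjoint_blocks (Z := Z) S.indep hm hB ?_
    rintro (n | n)
    · exact measurable_iSup_comap (Z := Z) (j := Sum.inl n) rfl
    · exact (measurable_orderStat hl hlk).comp (@measurable_pi_lambda _ _ _ (_) _ _ fun i =>
        measurable_iSup_comap (Z := Z) (j := Sum.inr (n, i)) ⟨i, rfl⟩)
  · have h := congrArg (Measure.map fun x : Fin k → ℝ => orderStat x l) (hrep n)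
    rw [Measure.map_map (measurable_orderStat hl hlk) (measurable_pi_lambda _ (S.measurable_task n)),
      Measure.map_map (measurable_orderStat hl hlk)
        (measurable_pi_lambda _ (S.measurable_task 0))] at h
    exact h

theorem ae_sojourn_eq_delay (hlam : 0 < lam) (hμ : 0 < μ) (hl : 1 ≤ l) (hlk : l ≤ k) {m : ℕ}
    [NeZero m] (hs : s = k * m) (n : ℕ) :
    S.sojourn n =ᵐ[S.P] fun ω => delay m (fun j => S.taskOrderStat j l ω)
      (fun j => S.interarrival j ω) n := by
  filter_upwards [(S.isQueueInput hlam hμ hl hlk).ae_nonneg] with ω hω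
  exact jobStart_add_sub_eq_delay hs (by omega)
    (by simpa [arrival] using hω.2 0)
    (fun n => by simp only [arrival]; rw [Finset.sum_range_succ]) hω.1 hω.2 n

theorem isStable_iff (hs : 0 < s) (hks : k ∣ s) (hlam : 0 < lam) (hμ : 0 < μ) (hl : 1 ≤ l)
    (hlk : l ≤ k) :
    S.IsStable ↔ lam < s * μ / (k * ((harmonic k : ℝ) - (harmonic (k - l) : ℝ))) := by
  obtain ⟨m, rfl⟩ := hks
  have : NeZero m := ⟨fun h => by simp [h] at hs⟩
  have hQ := S.isQueueInput hlam hμ hl hlk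
  have hae := S.ae_sojourn_eq_delay hlam hμ hl hlk (m := m) rfl
  have hload : (∫ ω, S.taskOrderStat 0 l ω ∂S.P < m * ∫ ω, S.interarrival 0 ω ∂S.P) ↔
      lam < (k * m : ℕ) * μ / (k * ((harmonic k : ℝ) - (harmonic (k - l) : ℝ))) := by
    rw [S.integral_taskOrderStat hμ 0 hl hlk, integral_of_map_eq_expMeasure hlam
      (S.measurable_interarrival 0) (S.law_interarrival 0)]
    have hH := harmonic_sub_pos hl hlk
    have hk : (0 : ℝ) < k := by exact_mod_cast (by omega : 0 < k)
    rw [Nat.cast_mul, mul_assoc, mul_div_mul_left _ _ hk.ne', lt_div_iff₀ hH, mul_one_div,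
      div_lt_div_iff₀ hμ hlam, mul_comm]
  rw [← hload]
  constructor
  · rintro ⟨ν, hν, h⟩
    refine hQ.integral_service_lt_of_tendstoInDistribution (fun K => ?_)
      (h.congr hae (ae_eq_refl _))
    have h1 := measureReal_lt_of_map_eq_expMeasure hlam (S.measurable_interarrival 0)
      (S.law_interarrival 0) (le_max_left 0 K)
    refine ((Real.exp_pos _).trans_eq h1.symm).trans_le (measureReal_mono fun ω hω => ?_)
    exact (le_max_right 0 K).trans (le_of_lt hω)
  · intro h
    obtain ⟨Z, hZ⟩ := hQ.exists_tendstoInDistribution_delay h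
    have hZ' := hZ.congr (fun n => (hae n).symm) (ae_eq_refl Z)
    have hν := Measure.isProbabilityMeasure_map hZ'.aemeasurable_limit
    refine ⟨S.P.map Z, hν, hZ'.forall_aemeasurable, aemeasurable_id, ?_⟩
    have h1 : (S.P.map Z).map (id : ℝ → ℝ) = S.P.map Z := Measure.map_id
    simp only [h1]
    exact hZ'.tendsto

/-- Barrier systems with any given rates exist, on a product space. -/
theorem nonempty (s k l : ℕ) {lam μ : ℝ} (hlam : 0 < lam) (hμ : 0 < μ) :
    Nonempty (SklSystem.{u} s k l lam μ) := by
  let Q : ℕ ⊕ (ℕ × Fin k) → Measure ℝ := Sum.elim (fun _ => expMeasure lam) fun _ => expMeasure μ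
  have hQ : ∀ j, IsProbabilityMeasure (Q j) := by
    rintro (n | p)
    exacts [isProbabilityMeasure_expMeasure hlam, isProbabilityMeasure_expMeasure hμ]
  let e : (ℕ ⊕ (ℕ × Fin k) → ℝ) → ULift.{u} (ℕ ⊕ (ℕ × Fin k) → ℝ) := ULift.up
  have he : Measurable e := measurable_up
  let P := (Measure.infinitePi Q).map e
  have hX : ∀ j, Measurable fun ω : ULift.{u} (ℕ ⊕ (ℕ × Fin k) → ℝ) => ω.down j := fun j =>
    (measurable_pi_apply j).comp measurable_down
  have hlaw : ∀ j, P.map (fun ω => ω.down j) = Q j := by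
    intro j
    rw [Measure.map_map (hX j) he]
    exact Measure.infinitePi_map_eval Q j
  have hprob : IsProbabilityMeasure P := Measure.isProbabilityMeasure_map he.aemeasurable
  have hind : iIndepFun (fun j (ω : ULift.{u} (ℕ ⊕ (ℕ × Fin k) → ℝ)) => ω.down j) P := by
    rw [iIndepFun_iff_map_fun_eq_infinitePi_map hX]
    simp only [hlaw]
    rw [Measure.map_map (measurable_pi_lambda _ hX) he]
    exact Measure.map_id
  refine ⟨{ Ω := ULift.{u} (ℕ ⊕ (ℕ × Fin k) → ℝ)
            P := P
            interarrival := fun n ω => ω.down (Sum.inl n)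
            task := fun n i ω => ω.down (Sum.inr (n, i))
            measurable_interarrival := fun n => hX _
            measurable_task := fun n i => hX _
            law_interarrival := fun n => hlaw _
            law_task := fun n i => hlaw _
            indep := ?_ }⟩
  convert hind using 1
  funext j
  rcases j with n | p <;> rfl

end SklSystem

/-- The numbers `lam * c` for `0 < lam < a` fill an interval. -/
theorem setOf_mul_eq_Ioo {a c : ℝ} (hc : 0 < c) :
    {ρ : ℝ | ∃ lam, 0 < lam ∧ lam < a ∧ ρ = lam * c} = Ioo 0 (a * c) := by
  ext ρ
  constructor
  · rintro ⟨lam, h0, h1, rfl⟩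
    exact ⟨mul_pos h0 hc, mul_lt_mul_of_pos_right h1 hc⟩
  · rintro ⟨h0, h1⟩
    exact ⟨ρ / c, div_pos h0 hc, (div_lt_iff₀ hc).2 h1, (div_mul_cancel₀ ρ hc.ne').symm⟩

theorem mainTheorem6 (s k l : ℕ) (hs : 0 < s) (hks : k ∣ s) (hl : 1 ≤ l) (hlk : l ≤ k)
    (μ : ℝ) (hμ : 0 < μ) :
    (∀ (lam : ℝ) (_ : 0 < lam) (S : SklSystem.{u} s k l lam μ),
      -- expected server times of every job
      (∀ n, Integrable (S.totalServerTime n) S.P ∧ ∫ ω, S.totalServerTime n ω ∂S.P = l / μ) ∧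
      (∀ n, Integrable (S.usefulServerTime n) S.P ∧
        ∫ ω, S.usefulServerTime n ω ∂S.P =
          (l - ((k : ℝ) - l) * ((harmonic k : ℝ) - (harmonic (k - l) : ℝ))) / μ) ∧
      -- the stability region
      (S.IsStable ↔ lam < s * μ / (k * ((harmonic k : ℝ) - (harmonic (k - l) : ℝ))))) ∧
    -- the utilizations of the stable systems, as the arrival rate varies
    {ρ : ℝ | ∃ (lam : ℝ) (_ : 0 < lam) (S : SklSystem.{u} s k l lam μ),
        S.IsStable ∧ ρ = S.utilization} =
      Ioo 0 (l / (k * ((harmonic k : ℝ) - (harmonic (k - l) : ℝ)))) ∧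
    -- their useful utilizations
    {ρ : ℝ | ∃ (lam : ℝ) (_ : 0 < lam) (S : SklSystem.{u} s k l lam μ),
        S.IsStable ∧ ρ = S.usefulUtilization} =
      Ioo 0 (l / (k * ((harmonic k : ℝ) - (harmonic (k - l) : ℝ))) - ((k : ℝ) - l) / k) := by
  have hs' : (0 : ℝ) < s := by exact_mod_cast hs
  have hl' : (0 : ℝ) < l := by exact_mod_cast (by omega : 0 < l)
  have hk' : (0 : ℝ) < k := by exact_mod_cast (by omega : 0 < k)
  have hH := harmonic_sub_pos hl hlk
  have hU := sub_mul_harmonic_sub_pos hl hlk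
  set H := (harmonic k : ℝ) - (harmonic (k - l) : ℝ) with hHdef
  -- both utilizations are proportional to the arrival rate
  have key : ∀ {c : ℝ} (hc : 0 < c) (f : ∀ lam, SklSystem.{u} s k l lam μ → ℝ)
      (_ : ∀ lam S, f lam S = lam * c),
      {ρ : ℝ | ∃ (lam : ℝ) (_ : 0 < lam) (S : SklSystem.{u} s k l lam μ),
        S.IsStable ∧ ρ = f lam S} = Ioo 0 (s * μ / (k * H) * c) := by
    intro c hc f hf
    rw [← setOf_mul_eq_Ioo hc]
    ext ρ
    constructor
    · rintro ⟨lam, h0, S, hS, rfl⟩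
      exact ⟨lam, h0, (S.isStable_iff hs hks h0 hμ hl hlk).1 hS, hf lam S⟩
    · rintro ⟨lam, h0, h1, rfl⟩
      obtain ⟨S⟩ := SklSystem.nonempty.{u} s k l h0 hμ
      exact ⟨lam, h0, S, (S.isStable_iff hs hks h0 hμ hl hlk).2 h1, (hf lam S).symm⟩
  refine ⟨fun lam hlam S => ⟨fun n => ⟨S.integrable_totalServerTime hμ hl hlk n,
    S.integral_totalServerTime hμ hl hlk n⟩, fun n => ⟨S.integrable_usefulServerTime hμ hlk n,
    S.integral_usefulServerTime hμ hlk n⟩, S.isStable_iff hs hks hlam hμ hl hlk⟩, ?_, ?_⟩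
  · rw [key (c := l / μ / s) (by positivity) (fun _ S => S.utilization) fun lam S => by
      rw [SklSystem.utilization, S.integral_totalServerTime hμ hl hlk]; ring]
    congr 1
    field_simp
  · rw [key (c := (l - ((k : ℝ) - l) * H) / μ / s) (by positivity)
      (fun _ S => S.usefulUtilization) fun lam S => by
        rw [SklSystem.usefulUtilization, S.integral_usefulServerTime hμ hlk]; ring]
    congr 1
    field_simp
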